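/- Proposition 6.2. Let $z\in\mathbb{C}\setminus(-\infty,0]$, $\zeta=(z/2)^{1/3}$ and $V_0=\frac{5-36\zeta^4}{144\zeta^6}$; all powers and square roots are principal, and $'=d/dz$. For $a,c\in\mathbb{C}\setminus\{0\}$ and $n\in\mathbb{Z}\setminus\{0\}$, $\delta=\operatorname{sgn} n$, let $$\chi_n^{(a,c)}=\zeta^{1/2}e^{-\frac32\delta\zeta^2}\sum_{k=0}^{2|n|-2}A_{|n|-1,k}(\delta\zeta^2)^k,$$ where the coefficients $A_{m,k}$ ($m,k\ge 0$) are determined by $A_{m,k}=\frac{3a}{k}A_{m-1,k-2}+\frac{k+1}{3}A_{m,k+1}$ for $m\ge1$, $k\ge2$, $A_{m,1}=\frac23A_{m,2}$ and $A_{m,0}=0$ for $m\geq 1$, $A_{0,k}=0$ for $k\ge1$, and $A_{m,2m}=(\frac{3a}{2})^m\frac{c}{m!}$. There are functions $\psi_n$ ($n\in\mathbb{Z}$, $\psi_0=0$), holomorphic in $z\in\mathbb{C}\setminus(-\infty,0]$, with the following properties. 1. They form a positive and a negative Jordan chain of generalized eigenfunctions of $V_0$: for every $n\ne0$, with $\delta=\operatorname{sgn}n$,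 $$\psi_n''+V_0\psi_n=\psi_{n-\delta},\qquad \psi_{\pm1}=3^{1/4}\zeta^{1/2}e^{\mp\frac32\zeta^2}.$$ 2. They agree with the explicit functions $\chi_n$, in the normalization $a=-\delta$, $c=3^{1/4}$, up to adding multiples of lower members of the same chain: for each $\delta\in\{1,-1\}$ there are constants $\kappa_0=1,\kappa_1,\kappa_2,\dots\in\mathbb{C}$ such that $\psi_{\delta n}=\sum_{j=0}^{n-1}\kappa_j\,\chi^{(-\delta,\,3^{1/4})}_{\delta(n-j)}$ for all $n\ge1$. 3. Their generating functions $\Psi=\sum_{n\ge1}\psi_n\lambda^{n-1}$ and $\tilde\Psi=\sum_{n\ge1}\psi_{-n}\lambda^{n-1}$ are given by $$\Psi=3^{\frac5{12}}\lambda^{-\frac16}e^{\frac1{4\lambda}}\sqrt{2\pi\zeta}\,\mathrm{Ai}\!\left(\Big(\frac{9}{\lambda^2}\Big)^{\frac13}\Big(\frac14+\lambda\zeta^2\Big)\right),\qquad \tilde\Psi=3^{\frac5{12}}\lambda^{-\frac16}e^{-\frac1{4\lambda}}\sqrt{\frac{\pi\zeta}{2}}\,\mathrm{Bi}\!\left(\Big(\frac{9}{\lambda^2}\Big)^{\frac13}\Big(\frac14+\lambda\zeta^2\Big)\right)$$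 in the sense of asymptotic expansions as $\lambda\to0$: for every fixed $z\in\mathbb{C}\setminus(-\infty,0]$, every $\eta>0$ and every $N\ge0$, the right-hand side of the first formula minus $\sum_{n=1}^{N}\psi_n\lambda^{n-1}$, and the right-hand side of the second formula minus $\sum_{n=1}^{N}\psi_{-n}\lambda^{n-1}$, are $O(\lambda^N)$ as $\lambda\to0$ in the sector $\lambda\neq 0$, $|\arg\lambda|\le\frac{\pi}{2}-\eta$. Here $\mathrm{Ai}$ and $\mathrm{Bi}$ are the standard Airy functions. -/

import Mathlib

open Complex Filter Topology Asymptotics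

/-! ### The Airy functions of a complex variable

`f(t) = ∑ t^{3k} / (9^k k! Γ(k+2/3))` and `g(t) = ∑ t^{3k+1} / (9^k k! Γ(k+4/3))` are entire and
span the solutions of `w'' = t w`.  The combinations below are the ones with the standard initial
values `Ai(0) = 3^{-2/3}/Γ(2/3)`, `Ai'(0) = -3^{-1/3}/Γ(1/3)`, `Bi(0) = 3^{-1/6}/Γ(2/3)`,
`Bi'(0) = 3^{1/6}/Γ(1/3)`. -/

/-- The first Airy series `∑ t^{3k} / (9^k k! Γ(k+2/3))`. -/
noncomputable def airyF (t : ℂ) : ℂ :=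
  ∑' k : ℕ, t ^ (3 * k) / ((9 : ℂ) ^ k * (k.factorial : ℂ) * Complex.Gamma ((k : ℂ) + 2 / 3))

/-- The second Airy series `∑ t^{3k+1} / (9^k k! Γ(k+4/3))`. -/
noncomputable def airyG (t : ℂ) : ℂ :=
  ∑' k : ℕ, t ^ (3 * k + 1) / ((9 : ℂ) ^ k * (k.factorial : ℂ) * Complex.Gamma ((k : ℂ) + 4 / 3))

/-- The standard Airy function `Ai` on the complex plane. -/
noncomputable def airyAi (t : ℂ) : ℂ :=
  (3 : ℂ) ^ (-(2 / 3) : ℂ) * airyF t - (3 : ℂ) ^ (-(4 / 3) : ℂ) * airyG t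

/-- The standard Airy function `Bi` on the complex plane. -/
noncomputable def airyBi (t : ℂ) : ℂ :=
  (3 : ℂ) ^ (-(1 / 6) : ℂ) * airyF t + (3 : ℂ) ^ (-(5 / 6) : ℂ) * airyG t

/-! ### The algebraic potential and its Jordan chains -/

/-- `ζ = (z/2)^{1/3}` (principal branch). -/
noncomputable def zetaVar (z : ℂ) : ℂ := (z / 2) ^ (1 / 3 : ℂ)

/-- The algebraic potential `V₀ = (5 - 36 ζ⁴) / (144 ζ⁶)`. -/
noncomputable def potentialV0 (z : ℂ) : ℂ :=
  (5 - 36 * zetaVar z ^ 4) / (144 * zetaVar z ^ 6)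

/-- The coefficients `A_{m,k}`, `m, k ≥ 0`, of the generalized eigenfunctions, with parameters
`a, c`.  They are the solution of the recursion
`A_{m,k} = (3a/k) A_{m-1,k-2} + ((k+1)/3) A_{m,k+1}` for `m ≥ 1`, `k ≥ 2`,
`A_{m,1} = (2/3) A_{m,2}` for `m ≥ 1`, with `A_{m,0} = 0` for `m ≥ 1`, `A_{0,k} = 0` for `k ≥ 1`
and `A_{m,2m} = (3a/2)^m c / m!`; see `chainCoeff_rec`, `chainCoeff_one`, `chainCoeff_zero_right`,
`chainCoeff_zero_left` and `chainCoeff_top`.  (The definition is the recursion solved downwards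
in `k`.) -/
noncomputable def chainCoeff (a c : ℂ) : ℕ → ℕ → ℂ
  | 0, k => if k = 0 then c else 0
  | m + 1, k =>
      if k = 0 then 0
      else ∑ j ∈ Finset.Icc (max k 2) (2 * m + 2),
        (3 * a / (j : ℂ)) * chainCoeff a c m (j - 2) *
          ((j.factorial : ℂ) / ((k.factorial : ℂ) * 3 ^ (j - k)))

/-- The explicit generalized eigenfunctions
`ζ^{1/2} e^{-(3/2) δ ζ²} ∑_{k=0}^{2|n|-2} A_{|n|-1,k} (δ ζ²)^k`, `δ = sgn n`, of `V₀`,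
for `n ≠ 0` (for `n = 0` the sum is empty and the function is `0`). -/
noncomputable def chainFun (a c : ℂ) (n : ℤ) (z : ℂ) : ℂ :=
  zetaVar z ^ (1 / 2 : ℂ) * Complex.exp (-(3 / 2) * (n.sign : ℂ) * zetaVar z ^ 2) *
    ∑ k ∈ Finset.range (2 * n.natAbs - 1),
      chainCoeff a c (n.natAbs - 1) k * ((n.sign : ℂ) * zetaVar z ^ 2) ^ k

theorem chainCoeff_zero_left (a c : ℂ) (k : ℕ) :
    chainCoeff a c 0 k = if k = 0 then c else 0 := by
  simp [chainCoeff]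

theorem chainCoeff_zero_right (a c : ℂ) (m : ℕ) : chainCoeff a c (m + 1) 0 = 0 := by
  simp [chainCoeff]

theorem chainCoeff_eq_zero (a c : ℂ) (m k : ℕ) (h : 2 * m < k) : chainCoeff a c m k = 0 := by
  cases m with
  | zero => simp only [chainCoeff]; rw [if_neg (by omega)]
  | succ m =>
    simp only [chainCoeff]
    rw [if_neg (by omega), Finset.Icc_eq_empty (by omega), Finset.sum_empty]

theorem chainCoeff_rec (a c : ℂ) (m k : ℕ) (hk : 2 ≤ k) :
    chainCoeff a c (m + 1) k =
      (3 * a / (k : ℂ)) * chainCoeff a c m (k - 2) +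
        (((k : ℂ) + 1) / 3) * chainCoeff a c (m + 1) (k + 1) := by
  by_cases h : k ≤ 2 * m + 2
  · simp only [chainCoeff]
    rw [if_neg (by omega), if_neg (by omega), max_eq_left hk, max_eq_left (by omega),
      ← Finset.add_sum_Ioc_eq_sum_Icc h, Finset.mul_sum]
    have h1 : (k.factorial : ℂ) ≠ 0 := by exact_mod_cast k.factorial_ne_zero
    congr 1
    · rw [Nat.sub_self, pow_zero, mul_one, div_self h1, mul_one]
    · refine Finset.sum_congr (by ext; simp) fun j hj => ?_
      have hj' := Finset.mem_Icc.mp hj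
      obtain ⟨d, rfl⟩ : ∃ d, j = k + 1 + d := ⟨j - (k + 1), by omega⟩
      have e1 : k + 1 + d - k = d + 1 := by omega
      have e2 : k + 1 + d - (k + 1) = d := by omega
      have h2 : ((k : ℂ) + 1) ≠ 0 := by exact_mod_cast k.succ_ne_zero
      rw [e1, e2, Nat.factorial_succ k]
      push_cast
      field_simp
      ring
  · rw [chainCoeff_eq_zero a c (m + 1) k (by omega), chainCoeff_eq_zero a c m (k - 2) (by omega),
      chainCoeff_eq_zero a c (m + 1) (k + 1) (by omega)]
    ring

theorem chainCoeff_one (a c : ℂ) (m : ℕ) :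
    chainCoeff a c (m + 1) 1 = (2 / 3) * chainCoeff a c (m + 1) 2 := by
  simp only [chainCoeff]
  rw [if_neg (by omega), if_neg (by omega), Finset.mul_sum]
  refine Finset.sum_congr (by simp) fun j hj => ?_
  have hj' := Finset.mem_Icc.mp hj
  obtain ⟨d, rfl⟩ : ∃ d, j = 2 + d := ⟨j - 2, by simp at hj'; omega⟩
  have e1 : 2 + d - 1 = d + 1 := by omega
  have e2 : 2 + d - 2 = d := by omega
  rw [e1, e2]
  norm_num [Nat.factorial]
  field_simp
  ring

theorem chainCoeff_top (a c : ℂ) (m : ℕ) :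
    chainCoeff a c m (2 * m) = (3 * a / 2) ^ m * c / (m.factorial : ℂ) := by
  induction m with
  | zero => simp [chainCoeff]
  | succ m ih =>
    rw [chainCoeff_rec a c m (2 * (m + 1)) (by omega),
      chainCoeff_eq_zero a c (m + 1) (2 * (m + 1) + 1) (by omega),
      show 2 * (m + 1) - 2 = 2 * m by omega, ih, Nat.factorial_succ]
    have h2 : ((m : ℂ) + 1) ≠ 0 := by exact_mod_cast m.succ_ne_zero
    have h1 : (m.factorial : ℂ) ≠ 0 := by exact_mod_cast m.factorial_ne_zero
    push_cast
    field_simp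
    ring

/-! ### The two closed forms -/

/-- `t(λ, z) = (9/λ²)^{1/3} (1/4 + λ ζ²)`, the argument of the Airy functions. -/
noncomputable def airyArg (l z : ℂ) : ℂ :=
  (9 / l ^ 2) ^ (1 / 3 : ℂ) * (1 / 4 + l * zetaVar z ^ 2)

/-- `3^{5/12} λ^{-1/6} e^{1/(4λ)} √(2πζ) Ai((9/λ²)^{1/3} (1/4 + λζ²))`. -/
noncomputable def genPos (l z : ℂ) : ℂ :=
  (3 : ℂ) ^ (5 / 12 : ℂ) * l ^ (-(1 / 6) : ℂ) * Complex.exp (1 / (4 * l)) *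
    (2 * (Real.pi : ℂ) * zetaVar z) ^ (1 / 2 : ℂ) * airyAi (airyArg l z)

/-- `3^{5/12} λ^{-1/6} e^{-1/(4λ)} √(πζ/2) Bi((9/λ²)^{1/3} (1/4 + λζ²))`. -/
noncomputable def genNeg (l z : ℂ) : ℂ :=
  (3 : ℂ) ^ (5 / 12 : ℂ) * l ^ (-(1 / 6) : ℂ) * Complex.exp (-(1 / (4 * l))) *
    ((Real.pi : ℂ) * zetaVar z / 2) ^ (1 / 2 : ℂ) * airyBi (airyArg l z)

/-- The punctured closed sector `{λ ≠ 0 : |arg λ| ≤ π/2 - η}` around the positive real axis. -/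
def sectorSet (η : ℝ) : Set ℂ := {l : ℂ | l ≠ 0 ∧ |Complex.arg l| ≤ Real.pi / 2 - η}

/-- `F(λ) ~ ∑_{n ≥ 1} u_n λ^{n-1}` as `λ → 0`, as an asymptotic expansion in the sense of Poincaré,
in every closed subsector of the right half-plane. -/
def HasGeneratingExpansion (F : ℂ → ℂ) (u : ℕ → ℂ) : Prop :=
  ∀ η : ℝ, 0 < η → ∀ N : ℕ,
    (fun l : ℂ => F l - ∑ n ∈ Finset.Icc 1 N, u n * l ^ (n - 1))
      =O[𝓝[sectorSet η] (0 : ℂ)] fun l : ℂ => l ^ N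

/-! Write x = ζ², μ = λ^{1/2}, K = (3/λ)^{1/3}, so that K³μ² = 3 and the Airy argument is t = K²(1/4
+ μ²x). Both Airy functions are combinations of integrals of exp(s³/3 - ts) along rays. Substituting
s = δK/2 + Kμv, with δ = 1 for Ai and δ = -1 for Bi, turns the exponent into -δ/(4λ) - 3δx/2 +
3δv²/2 + μ(v³ - 3xv) (`airyKernel_shift`). The first term cancels against the exponential prefactor,
the second is the exponential in ψ_{±1}, and expanding exp(μ(v³ - 3xv)) leaves moments of a
Gaussian. Since v^{3j-2k} has the parity of j, only even powers of μ survive, hence integral powers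
of λ; the coefficient of λ^m is a polynomial Q_m(x), `momentPoly`. The functions ψ are defined by
these polynomials, algebraically.

The Jordan chain: in the variable x the operator d²/dz² + V₀ is (d²/dx² - 9/4)/(9x) after removal of
ζ^{1/2} (`schrodinger_zetaVar_sqrt_mul`), so the chain relation says Q_{m+1}'' - 3δ Q_{m+1}' = 9x
Q_m. Formally this is integration by parts in v, because 9μ²v² + 9δμv - 9μ²x is 3μ times the
v-derivative of the exponent; the proof checks it on coefficients through the moment recursion. The
coefficients A_{m,k} obey the same recursion but vanish at k = 0 for m ≥ 1, so Q_m differs from the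
explicit polynomials by lower members weighted with the constants Q_j(0)
(`momentCoeff_eq_sum_chainCoeff`).

The expansion: `airyAi_eq_airyRay` and `airyBi_eq_airyRay` come from comparing power series.
`airyRay_eq_shift` moves each ray to the critical point and rotates it, at the cost of a primitive
evaluated between 0 and that point; this cost is the same for all rays and disappears because the
coefficients (1, -1) and (1, 1, -2) sum to zero. `gaussRay_expansion` then gives a remainder O(μ^J),
along directions where the Gaussian decays and the cubic term does not grow. -/

/-! ### Gaussian moments and the coefficients A_{m,k} -/

/-- The normalized moments of the Gaussian weight `e^{3δv²/2}`: `e₀ = 1`, `e₁ = 0` and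
`e_{n+2} = -(n+1)/(3δ) e_n`. -/
noncomputable def gaussMoment (δ : ℂ) : ℕ → ℂ
  | 0 => 1
  | 1 => 0
  | n + 2 => ((n : ℂ) + 1) / (-3 * δ) * gaussMoment δ n

theorem gaussMoment_add_two (δ : ℂ) (n : ℕ) :
    gaussMoment δ (n + 2) = ((n : ℂ) + 1) / (-3 * δ) * gaussMoment δ n := rfl

theorem cast_factorial_add_two (k : ℕ) :
    ((k + 2).factorial : ℂ) = ((k : ℂ) + 2) * ((k + 1) * k.factorial) := by
  simp only [Nat.factorial_succ]
  push_cast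
  ring

theorem cast_factorial_add_three (k : ℕ) :
    ((k + 3).factorial : ℂ) = ((k : ℂ) + 3) * ((k + 2) * ((k + 1) * k.factorial)) := by
  simp only [Nat.factorial_succ]
  push_cast
  ring

theorem gaussMoment_odd (δ : ℂ) (m : ℕ) : gaussMoment δ (2 * m + 1) = 0 := by
  induction m with
  | zero => rfl
  | succ m ih => rw [show 2 * (m + 1) + 1 = 2 * m + 1 + 2 by ring, gaussMoment, ih, mul_zero]

/-- The coefficient of `x^k` in the `j`-th moment of `(v³ - 3xv)^j / j!`. -/
noncomputable def momentCoeff (δ : ℂ) (j k : ℕ) : ℂ :=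
  if k ≤ j then (-3) ^ k * gaussMoment δ (3 * j - 2 * k) /
    ((k.factorial : ℂ) * ((j - k).factorial : ℂ)) else 0

theorem momentCoeff_eq_zero (δ : ℂ) {j k : ℕ} (h : j < k) : momentCoeff δ j k = 0 :=
  if_neg (by omega)

theorem momentCoeff_odd (δ : ℂ) (m k : ℕ) : momentCoeff δ (2 * m + 1) k = 0 := by
  by_cases h : k ≤ 2 * m + 1
  · rw [momentCoeff, if_pos h,
      show 3 * (2 * m + 1) - 2 * k = 2 * (3 * m + 1 - k) + 1 by omega, gaussMoment_odd]
    simp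
  · exact momentCoeff_eq_zero δ (by omega)

theorem momentCoeff_zero_zero (δ : ℂ) : momentCoeff δ 0 0 = 1 := by
  simp [momentCoeff, gaussMoment]

/-- The coefficients at (j+2, k+3) and at (j, k) both carry the moment of index 3j - 2k, and the one
at (j+2, k+2) carries index 3j - 2k + 2, so a single step of the moment recursion relates all three.
On the diagonal k = j the first coefficient is zero. -/
theorem momentCoeff_rec {δ : ℂ} (hδ : δ ≠ 0) (j k : ℕ) :
    ((k : ℂ) + 3) * (k + 2) * momentCoeff δ (j + 2) (k + 3)
      - 3 * δ * (k + 2) * momentCoeff δ (j + 2) (k + 2) = 9 * momentCoeff δ j k := by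
  have h1 : ((k : ℂ) + 1) ≠ 0 := by exact_mod_cast k.succ_ne_zero
  have h2 : ((k : ℂ) + 2) ≠ 0 := by exact_mod_cast (k + 1).succ_ne_zero
  have h3 : ((k : ℂ) + 3) ≠ 0 := by exact_mod_cast (k + 2).succ_ne_zero
  have hk : (k.factorial : ℂ) ≠ 0 := by exact_mod_cast k.factorial_ne_zero
  rcases lt_trichotomy k j with h | rfl | h
  · obtain ⟨d, rfl⟩ : ∃ d, j = k + 1 + d := ⟨j - (k + 1), by omega⟩
    have hd : (d.factorial : ℂ) ≠ 0 := by exact_mod_cast d.factorial_ne_zero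
    have hd1 : ((d : ℂ) + 1) ≠ 0 := by exact_mod_cast d.succ_ne_zero
    rw [momentCoeff, momentCoeff, momentCoeff, if_pos (by omega), if_pos (by omega),
      if_pos (by omega), show 3 * (k + 1 + d + 2) - 2 * (k + 3) = 3 * (k + 1 + d) - 2 * k by omega,
      show 3 * (k + 1 + d + 2) - 2 * (k + 2) = 3 * (k + 1 + d) - 2 * k + 2 by omega, gaussMoment,
      show k + 1 + d + 2 - (k + 3) = d by omega, show k + 1 + d + 2 - (k + 2) = d + 1 by omega,
      show k + 1 + d - k = d + 1 by omega,
      show 3 * (k + 1 + d) - 2 * k = k + 3 + 3 * d by omega]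
    rw [cast_factorial_add_three, cast_factorial_add_two, Nat.factorial_succ d]
    push_cast
    field_simp
    ring
  · rw [momentCoeff_eq_zero δ (show k + 2 < k + 3 by omega), momentCoeff, momentCoeff,
      if_pos le_rfl, if_pos le_rfl, show 3 * (k + 2) - 2 * (k + 2) = k + 2 by omega, gaussMoment,
      show 3 * k - 2 * k = k by omega]
    rw [cast_factorial_add_two]
    simp only [Nat.sub_self]
    field_simp
    ring
  · rw [momentCoeff_eq_zero δ (show j + 2 < k + 3 by omega),
      momentCoeff_eq_zero δ (show j + 2 < k + 2 by omega), momentCoeff_eq_zero δ h]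
    ring

/-- The boundary case of the same recursion, needed for the constant coefficient of the differential
equation, where the right-hand side 9x Q_m contributes nothing. -/
theorem momentCoeff_one {δ : ℂ} (hδ : δ ≠ 0) (j : ℕ) :
    2 * momentCoeff δ (j + 2) 2 = 3 * δ * momentCoeff δ (j + 2) 1 := by
  have hd : (j.factorial : ℂ) ≠ 0 := by exact_mod_cast j.factorial_ne_zero
  have hd1 : ((j : ℂ) + 1) ≠ 0 := by exact_mod_cast j.succ_ne_zero
  rw [momentCoeff, momentCoeff, if_pos (by omega), if_pos (by omega),
    show 3 * (j + 2) - 2 * 2 = 3 * j + 2 by omega,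
    show 3 * (j + 2) - 2 * 1 = 3 * j + 2 + 2 by omega, show j + 2 - 2 = j by omega,
    show j + 2 - 1 = j + 1 by omega,
    gaussMoment_add_two δ (3 * j + 2)]
  generalize gaussMoment δ (3 * j + 2) = e
  simp only [Nat.factorial_succ, Nat.factorial_zero]
  push_cast
  field_simp
  ring

/-- The moment coefficients are combinations of the coefficients of the explicit generalized
eigenfunctions. -/
theorem momentCoeff_eq_sum_chainCoeff {δ : ℂ} (hδ : δ ^ 2 = 1) (c : ℂ) (m k : ℕ) :
    c * δ ^ k * momentCoeff δ (2 * m) k =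
      ∑ j ∈ Finset.range (m + 1), momentCoeff δ (2 * j) 0 * chainCoeff (-δ) c (m - j) k := by
  have hδ0 : δ ≠ 0 := by rintro rfl; norm_num at hδ
  induction m generalizing k with
  | zero =>
    rw [Finset.sum_range_one]
    rcases Nat.eq_zero_or_pos k with rfl | hk
    · simp [momentCoeff_zero_zero, chainCoeff_zero_left]
    · rw [momentCoeff_eq_zero δ (by omega), chainCoeff_zero_left, if_neg hk.ne']
      simp
  | succ m ih =>
    -- Both sides satisfy the same recursion in k, with inhomogeneity given by the induction
    -- hypothesis for m at k - 2; equality therefore descends from k + 1 to k as long as k ≥ 2.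
    have step : ∀ k, 2 ≤ k →
        c * δ ^ (k + 1) * momentCoeff δ (2 * (m + 1)) (k + 1) =
          ∑ j ∈ Finset.range (m + 1 + 1),
            momentCoeff δ (2 * j) 0 * chainCoeff (-δ) c (m + 1 - j) (k + 1) →
        c * δ ^ k * momentCoeff δ (2 * (m + 1)) k =
          ∑ j ∈ Finset.range (m + 1 + 1),
            momentCoeff δ (2 * j) 0 * chainCoeff (-δ) c (m + 1 - j) k := by
      intro k hk h
      rw [Finset.sum_range_succ, Nat.sub_self, chainCoeff_zero_left, if_neg (by omega), mul_zero,
        add_zero] at h ⊢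
      have hsum : ∑ j ∈ Finset.range (m + 1),
            momentCoeff δ (2 * j) 0 * chainCoeff (-δ) c (m + 1 - j) k =
          3 * (-δ) / k * ∑ j ∈ Finset.range (m + 1),
              momentCoeff δ (2 * j) 0 * chainCoeff (-δ) c (m - j) (k - 2) +
            ((k : ℂ) + 1) / 3 * ∑ j ∈ Finset.range (m + 1),
              momentCoeff δ (2 * j) 0 * chainCoeff (-δ) c (m + 1 - j) (k + 1) := by
        rw [Finset.mul_sum, Finset.mul_sum, ← Finset.sum_add_distrib]
        refine Finset.sum_congr rfl fun j hj => ?_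
        have hj' := Finset.mem_range.mp hj
        rw [show m + 1 - j = m - j + 1 by omega, chainCoeff_rec _ _ _ _ hk]
        ring
      obtain ⟨i, rfl⟩ : ∃ i, k = i + 2 := ⟨k - 2, by omega⟩
      rw [hsum, ← h, show i + 2 - 2 = i by omega, ← ih i]
      have hr := momentCoeff_rec hδ0 (2 * m) i
      have h2 : ((i : ℂ) + 2) ≠ 0 := by exact_mod_cast (i + 1).succ_ne_zero
      have e : 2 * (m + 1) = 2 * m + 2 := by ring
      have e3 : i + 2 + 1 = i + 3 := by ring
      rw [e, e3]
      push_cast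
      field_simp
      rw [show δ ^ (i + 2) = δ ^ i * δ ^ 2 by ring, show δ ^ (i + 3) = δ ^ i * δ ^ 2 * δ by ring, hδ]
      generalize momentCoeff δ (2 * m + 2) (i + 3) = b3 at *
      generalize momentCoeff δ (2 * m + 2) (i + 2) = b2 at *
      generalize momentCoeff δ (2 * m) i = b0 at *
      linear_combination (-c * δ ^ i * δ) * hr - 3 * c * δ ^ i * (i + 2) * b2 * hδ
    -- Descending induction on k, run as induction on the distance d: beyond k = 2(m + 1) both sides
    -- vanish.
    have hge : ∀ d k, 2 ≤ k → 2 * (m + 1) < k + d →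
        c * δ ^ k * momentCoeff δ (2 * (m + 1)) k =
          ∑ j ∈ Finset.range (m + 1 + 1),
            momentCoeff δ (2 * j) 0 * chainCoeff (-δ) c (m + 1 - j) k := by
      intro d
      induction d with
      | zero =>
        intro k _ hk
        rw [momentCoeff_eq_zero δ (by omega), Finset.sum_eq_zero fun j _ => by
          rw [chainCoeff_eq_zero _ _ _ _ (by omega), mul_zero], mul_zero]
      | succ d ihd => exact fun k h2 hk => step k h2 (ihd (k + 1) (by omega) (by omega))
    rcases Nat.lt_or_ge k 2 with hk | hk
    · interval_cases k
      -- At k = 0 only j = m + 1 contributes, since A_{i,0} = 0 for i ≥ 1; this is what forces the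
      -- weights to be the constant terms.
      · rw [Finset.sum_range_succ, Finset.sum_eq_zero fun j hj => ?_, Nat.sub_self,
          chainCoeff_zero_left]
        · simp
          ring
        · have hj' := Finset.mem_range.mp hj
          rw [show m + 1 - j = m - j + 1 by omega, chainCoeff_zero_right, mul_zero]
      · have h2 := hge (2 * m + 1) 2 le_rfl (by omega)
        rw [Finset.sum_range_succ, Nat.sub_self, chainCoeff_zero_left, if_neg (by omega), mul_zero,
          add_zero] at h2 ⊢
        have hsum : ∑ j ∈ Finset.range (m + 1),
              momentCoeff δ (2 * j) 0 * chainCoeff (-δ) c (m + 1 - j) 1 =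
            2 / 3 * ∑ j ∈ Finset.range (m + 1),
              momentCoeff δ (2 * j) 0 * chainCoeff (-δ) c (m + 1 - j) 2 := by
          rw [Finset.mul_sum]
          refine Finset.sum_congr rfl fun j hj => ?_
          have hj' := Finset.mem_range.mp hj
          rw [show m + 1 - j = m - j + 1 by omega, chainCoeff_one]
          ring
        rw [hsum, ← h2, show 2 * (m + 1) = 2 * m + 2 by ring]
        have h1 := momentCoeff_one hδ0 (2 * m)
        linear_combination (-c * δ ^ 2 / 3) * h1 - c * δ * momentCoeff δ (2 * m + 2) 1 * hδ
    · exact hge (2 * (m + 1) + 1) k hk (by omega)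

/-! ### The polynomials Q_m and their differential recursion -/

/-- The polynomial factor of the generalized eigenfunctions. -/
noncomputable def momentPoly (δ : ℂ) (m : ℕ) : Polynomial ℂ :=
  ∑ k ∈ Finset.range (2 * m + 1), Polynomial.monomial k (momentCoeff δ (2 * m) k)

theorem momentPoly_coeff (δ : ℂ) (m k : ℕ) :
    (momentPoly δ m).coeff k = momentCoeff δ (2 * m) k := by
  rw [momentPoly, Polynomial.finsetSum_coeff]
  simp only [Polynomial.coeff_monomial]
  rw [Finset.sum_ite_eq']
  split_ifs with h
  · rfl
  · rw [momentCoeff_eq_zero δ (by simpa using h)]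

theorem momentPoly_zero (δ : ℂ) : momentPoly δ 0 = 1 := by
  simp [momentPoly, momentCoeff_zero_zero]

theorem momentPoly_eval (δ x : ℂ) (m : ℕ) :
    (momentPoly δ m).eval x = ∑ k ∈ Finset.range (2 * m + 1), momentCoeff δ (2 * m) k * x ^ k := by
  simp [momentPoly, Polynomial.eval_finsetSum]

theorem momentPoly_derivative {δ : ℂ} (hδ : δ ≠ 0) (m : ℕ) :
    Polynomial.derivative (Polynomial.derivative (momentPoly δ (m + 1)))
      - Polynomial.C (3 * δ) * Polynomial.derivative (momentPoly δ (m + 1)) =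
      Polynomial.C 9 * (Polynomial.X * momentPoly δ m) := by
  ext i
  rw [Polynomial.coeff_sub, Polynomial.coeff_C_mul, Polynomial.coeff_C_mul,
    Polynomial.coeff_derivative, Polynomial.coeff_derivative, Polynomial.coeff_derivative,
    momentPoly_coeff, momentPoly_coeff]
  cases i with
  | zero =>
    rw [Polynomial.coeff_X_mul_zero, show 2 * (m + 1) = 2 * m + 2 by ring]
    have := momentCoeff_one hδ (2 * m)
    push_cast
    linear_combination this
  | succ i =>
    rw [Polynomial.coeff_X_mul, momentPoly_coeff, show 2 * (m + 1) = 2 * m + 2 by ring]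
    have := momentCoeff_rec hδ (2 * m) i
    push_cast
    rw [show i + 1 + 1 + 1 = i + 3 by ring, show i + 1 + 1 = i + 2 by ring]
    linear_combination this

/-! ### The variable ζ and the operator d²/dz² + V₀ -/

theorem div_two_mem_slitPlane {z : ℂ} (hz : z ∈ slitPlane) : z / 2 ∈ slitPlane := by
  rw [mem_slitPlane_iff] at hz ⊢
  simpa using hz

theorem zetaVar_eq_exp {z : ℂ} (hz : z ∈ slitPlane) : zetaVar z = exp (log (z / 2) / 3) := by
  rw [zetaVar, cpow_def_of_ne_zero (slitPlane_ne_zero (div_two_mem_slitPlane hz))]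
  congr 1
  ring

theorem zetaVar_ne_zero {z : ℂ} (hz : z ∈ slitPlane) : zetaVar z ≠ 0 := by
  rw [zetaVar_eq_exp hz]
  exact exp_ne_zero _

/-- Dividing the argument by 3 keeps it inside (-π, π], so no branch is crossed. This lets the
principal square root of ζ be written as an exponential of log(z/2). -/
theorem log_zetaVar {z : ℂ} (hz : z ∈ slitPlane) : log (zetaVar z) = log (z / 2) / 3 := by
  have h1 := neg_pi_lt_arg (z / 2)
  have h2 := arg_le_pi (z / 2)
  have h3 := Real.pi_pos
  have h : (log (z / 2) / 3).im = arg (z / 2) / 3 := by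
    rw [show (3 : ℂ) = ((3 : ℝ) : ℂ) by norm_num, div_ofReal_im, log_im]
  rw [zetaVar_eq_exp hz, log_exp] <;> rw [h] <;> linarith

theorem zetaVar_sqrt_eq_exp {z : ℂ} (hz : z ∈ slitPlane) :
    zetaVar z ^ (1 / 2 : ℂ) = exp (log (z / 2) / 6) := by
  rw [cpow_def_of_ne_zero (zetaVar_ne_zero hz), log_zetaVar hz]
  congr 1
  ring

theorem zetaVar_cube {z : ℂ} (hz : z ∈ slitPlane) : 2 * zetaVar z ^ 3 = z := by
  rw [zetaVar_eq_exp hz, ← exp_nat_mul]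
  rw [show ((3 : ℕ) : ℂ) * (log (z / 2) / 3) = log (z / 2) by push_cast; ring,
    exp_log (slitPlane_ne_zero (div_two_mem_slitPlane hz))]
  ring

theorem hasDerivAt_log_div_two {z : ℂ} (hz : z ∈ slitPlane) :
    HasDerivAt (fun z => log (z / 2)) (1 / z) z := by
  have h := ((hasDerivAt_id z).div_const 2).clog (div_two_mem_slitPlane hz)
  refine h.congr_deriv ?_
  have := slitPlane_ne_zero hz
  change 1 / 2 / (z / 2) = 1 / z
  field_simp

theorem hasDerivAt_zetaVar {z : ℂ} (hz : z ∈ slitPlane) :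
    HasDerivAt zetaVar (1 / (6 * zetaVar z ^ 2)) z := by
  have h := ((hasDerivAt_log_div_two hz).div_const 3).cexp
  refine (h.congr_of_eventuallyEq ?_).congr_deriv ?_
  · filter_upwards [isOpen_slitPlane.mem_nhds hz] with w hw using zetaVar_eq_exp hw
  · rw [← zetaVar_eq_exp hz]
    -- Writing z as 2ζ³ makes the identity rational in ζ.
    nth_rewrite 2 [← zetaVar_cube hz]
    have := zetaVar_ne_zero hz
    field_simp
    norm_num

theorem hasDerivAt_zetaVar_sqrt {z : ℂ} (hz : z ∈ slitPlane) :
    HasDerivAt (fun z => zetaVar z ^ (1 / 2 : ℂ))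
      (zetaVar z ^ (1 / 2 : ℂ) / (12 * zetaVar z ^ 3)) z := by
  have h := ((hasDerivAt_log_div_two hz).div_const 6).cexp
  refine (h.congr_of_eventuallyEq ?_).congr_deriv ?_
  · filter_upwards [isOpen_slitPlane.mem_nhds hz] with w hw using zetaVar_sqrt_eq_exp hw
  · rw [← zetaVar_sqrt_eq_exp hz]
    nth_rewrite 2 [← zetaVar_cube hz]
    have := zetaVar_ne_zero hz
    field_simp
    ring

theorem hasDerivAt_zetaVar_sqrt_mul {z : ℂ} (hz : z ∈ slitPlane) {h : ℂ → ℂ} {h' : ℂ}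
    (hh : HasDerivAt h h' (zetaVar z ^ 2)) :
    HasDerivAt (fun z => zetaVar z ^ (1 / 2 : ℂ) * h (zetaVar z ^ 2))
      (zetaVar z ^ (1 / 2 : ℂ) *
        (h (zetaVar z ^ 2) / (12 * zetaVar z ^ 3) + h' / (3 * zetaVar z))) z := by
  have h2 : HasDerivAt (fun z => zetaVar z ^ 2) (1 / (3 * zetaVar z)) z := by
    refine ((hasDerivAt_zetaVar hz).pow 2).congr_deriv ?_
    have := zetaVar_ne_zero hz
    field_simp
    ring
  refine ((hasDerivAt_zetaVar_sqrt hz).mul (hh.comp z h2)).congr_deriv ?_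
  rw [Function.comp_apply]
  ring

/-- In the variable `x = ζ²` the operator `d²/dz² + V₀` becomes `(d²/dx² - 9/4) / (9x)`. -/
theorem schrodinger_zetaVar_sqrt_mul {z : ℂ} (hz : z ∈ slitPlane) {h h' h'' : ℂ → ℂ}
    (hh : ∀ x, HasDerivAt h (h' x) x) (hh' : ∀ x, HasDerivAt h' (h'' x) x) :
    deriv (deriv fun z => zetaVar z ^ (1 / 2 : ℂ) * h (zetaVar z ^ 2)) z +
      potentialV0 z * (zetaVar z ^ (1 / 2 : ℂ) * h (zetaVar z ^ 2)) =
      zetaVar z ^ (1 / 2 : ℂ) *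
        ((h'' (zetaVar z ^ 2) - 9 / 4 * h (zetaVar z ^ 2)) / (9 * zetaVar z ^ 2)) := by
  have hev : (deriv fun z => zetaVar z ^ (1 / 2 : ℂ) * h (zetaVar z ^ 2)) =ᶠ[𝓝 z] fun z =>
      zetaVar z ^ (1 / 2 : ℂ) * h (zetaVar z ^ 2) * (1 / (12 * zetaVar z ^ 3)) +
        zetaVar z ^ (1 / 2 : ℂ) * h' (zetaVar z ^ 2) * (1 / (3 * zetaVar z)) := by
    filter_upwards [isOpen_slitPlane.mem_nhds hz] with w hw
    rw [(hasDerivAt_zetaVar_sqrt_mul hw (hh _)).deriv]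
    ring
  have h0 := zetaVar_ne_zero hz
  have hz3 : HasDerivAt (fun z => 1 / (12 * zetaVar z ^ 3)) (-1 / (24 * zetaVar z ^ 6)) z := by
    have := (((hasDerivAt_zetaVar hz).pow 3).const_mul 12).inv (mul_ne_zero (by norm_num) (pow_ne_zero 3 h0))
    refine (this.congr_of_eventuallyEq (.of_forall fun w => ?_)).congr_deriv ?_
    · simp
    · simp only [Pi.pow_apply]
      field_simp
      ring
  have hz1 : HasDerivAt (fun z => 1 / (3 * zetaVar z)) (-1 / (18 * zetaVar z ^ 4)) z := by
    have := ((hasDerivAt_zetaVar hz).const_mul 3).inv (mul_ne_zero (by norm_num) h0)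
    refine (this.congr_of_eventuallyEq (.of_forall fun w => ?_)).congr_deriv ?_
    · simp
    · field_simp
      norm_num
  have hd := ((hasDerivAt_zetaVar_sqrt_mul hz (hh _)).mul hz3).add
    ((hasDerivAt_zetaVar_sqrt_mul hz (hh' _)).mul hz1)
  rw [(hev.deriv_eq.trans hd.deriv : deriv (deriv _) z = _), potentialV0]
  field_simp
  ring

/-! ### Generalized eigenfunctions -/

/-- The generalized eigenfunction `3^{1/4} ζ^{1/2} e^{-(3/2)δζ²} Q_m(ζ²)`. -/
noncomputable def genEig (δ : ℂ) (m : ℕ) (z : ℂ) : ℂ :=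
  zetaVar z ^ (1 / 2 : ℂ) * ((3 : ℂ) ^ (1 / 4 : ℂ) * exp (-(3 / 2) * δ * zetaVar z ^ 2) *
    (momentPoly δ m).eval (zetaVar z ^ 2))

theorem hasDerivAt_exp_mul_eval (c δ : ℂ) (p : Polynomial ℂ) (x : ℂ) :
    HasDerivAt (fun x => c * exp (-(3 / 2) * δ * x) * p.eval x)
      (c * exp (-(3 / 2) * δ * x) *
        (Polynomial.derivative p - Polynomial.C (3 / 2 * δ) * p).eval x) x := by
  have h := (((hasDerivAt_id x).const_mul (-(3 / 2) * δ)).cexp.const_mul c).mul (p.hasDerivAt x)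
  refine h.congr_deriv ?_
  simp only [Polynomial.eval_sub, Polynomial.eval_mul, Polynomial.eval_C, id]
  ring

theorem differentiableAt_genEig (δ : ℂ) (m : ℕ) {z : ℂ} (hz : z ∈ slitPlane) :
    DifferentiableAt ℂ (genEig δ m) z :=
  (hasDerivAt_zetaVar_sqrt_mul hz (hasDerivAt_exp_mul_eval ((3 : ℂ) ^ (1 / 4 : ℂ)) δ
    (momentPoly δ m) _)).differentiableAt

/-- Conjugating d²/dx² - 9/4 by e^{-3δx/2} gives Q'' - 3δQ' + (9/4)(δ² - 1)Q, and the last term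
vanishes because δ² = 1. -/
theorem schrodinger_genEig {δ : ℂ} (hδ : δ ^ 2 = 1) (m : ℕ) {z : ℂ} (hz : z ∈ slitPlane) :
    deriv (deriv (genEig δ m)) z + potentialV0 z * genEig δ m z =
      zetaVar z ^ (1 / 2 : ℂ) * ((3 : ℂ) ^ (1 / 4 : ℂ) * exp (-(3 / 2) * δ * zetaVar z ^ 2) *
        (Polynomial.derivative (Polynomial.derivative (momentPoly δ m))
          - Polynomial.C (3 * δ) * Polynomial.derivative (momentPoly δ m)).eval (zetaVar z ^ 2) /
            (9 * zetaVar z ^ 2)) := by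
  refine (schrodinger_zetaVar_sqrt_mul hz (hasDerivAt_exp_mul_eval _ δ (momentPoly δ m))
    (hasDerivAt_exp_mul_eval _ δ _)).trans ?_
  simp only [Polynomial.eval_sub, Polynomial.eval_mul, Polynomial.eval_C, Polynomial.derivative_sub,
    Polynomial.derivative_mul, Polynomial.derivative_C, Polynomial.eval_add, Polynomial.eval_zero]
  congr 2
  linear_combination ((3 : ℂ) ^ (1 / 4 : ℂ) * exp (-(3 / 2) * δ * zetaVar z ^ 2)) * (9 / 4) *
    Polynomial.eval (zetaVar z ^ 2) (momentPoly δ m) * hδ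

theorem schrodinger_genEig_zero {δ : ℂ} (hδ : δ ^ 2 = 1) {z : ℂ} (hz : z ∈ slitPlane) :
    deriv (deriv (genEig δ 0)) z + potentialV0 z * genEig δ 0 z = 0 := by
  rw [schrodinger_genEig hδ 0 hz, momentPoly_zero]
  simp

theorem schrodinger_genEig_succ {δ : ℂ} (hδ : δ ^ 2 = 1) (m : ℕ) {z : ℂ} (hz : z ∈ slitPlane) :
    deriv (deriv (genEig δ (m + 1))) z + potentialV0 z * genEig δ (m + 1) z = genEig δ m z := by
  have hδ0 : δ ≠ 0 := by rintro rfl; norm_num at hδ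
  rw [schrodinger_genEig hδ (m + 1) hz, momentPoly_derivative hδ0, genEig]
  have := zetaVar_ne_zero hz
  simp only [Polynomial.eval_mul, Polynomial.eval_C, Polynomial.eval_X]
  field_simp

theorem genEig_eq_sum_chainFun {δ : ℤ} (hδ : δ = 1 ∨ δ = -1) (m : ℕ) (z : ℂ) :
    genEig δ m z = ∑ j ∈ Finset.range (m + 1), momentCoeff δ (2 * j) 0 *
      chainFun (-(δ : ℂ)) ((3 : ℂ) ^ (1 / 4 : ℂ)) (δ * (((m + 1 : ℕ) : ℤ) - (j : ℤ))) z := by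
  have hδ2 : (δ : ℂ) ^ 2 = 1 := by rcases hδ with rfl | rfl <;> norm_num
  have hterm : ∀ j ∈ Finset.range (m + 1),
      chainFun (-(δ : ℂ)) ((3 : ℂ) ^ (1 / 4 : ℂ)) (δ * (((m + 1 : ℕ) : ℤ) - (j : ℤ))) z =
        zetaVar z ^ (1 / 2 : ℂ) * exp (-(3 / 2) * δ * zetaVar z ^ 2) *
          ∑ k ∈ Finset.range (2 * m + 1),
            chainCoeff (-(δ : ℂ)) ((3 : ℂ) ^ (1 / 4 : ℂ)) (m - j) k * (δ * zetaVar z ^ 2) ^ k := by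
    intro j hj
    have hj' := Finset.mem_range.mp hj
    obtain ⟨d, rfl⟩ : ∃ d, m = j + d := ⟨m - j, by omega⟩
    have e : (((j + d + 1 : ℕ) : ℤ) - (j : ℤ)) = ((d + 1 : ℕ) : ℤ) := by push_cast; ring
    have hs : (δ * ((d + 1 : ℕ) : ℤ)).sign = δ := by
      rcases hδ with rfl | rfl
      · rw [one_mul]; exact Int.sign_natCast_add_one d
      · rw [neg_one_mul, Int.sign_neg]; exact congrArg Neg.neg (Int.sign_natCast_add_one d)
    have hn : (δ * ((d + 1 : ℕ) : ℤ)).natAbs = d + 1 := by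
      rcases hδ with rfl | rfl <;> simp <;> omega
    rw [e, chainFun, hs, hn, show j + d - j = d by omega, show d + 1 - 1 = d by omega]
    congr 1
    -- The summation range is enlarged to one that does not depend on j; the added coefficients lie
    -- above the top degree and vanish.
    refine Finset.sum_subset (Finset.range_subset_range.mpr (by omega)) fun k _ hk => ?_
    rw [chainCoeff_eq_zero _ _ _ _ (by simp at hk; omega), zero_mul]
  rw [Finset.sum_congr rfl fun j hj => by rw [hterm j hj], genEig, momentPoly_eval]
  simp only [Finset.mul_sum]
  rw [Finset.sum_comm]
  refine Finset.sum_congr rfl fun k _ => ?_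
  have h := momentCoeff_eq_sum_chainCoeff hδ2 ((3 : ℂ) ^ (1 / 4 : ℂ)) m k
  have hk : (δ : ℂ) ^ k * (δ : ℂ) ^ k = 1 := by rw [← mul_pow, ← sq, hδ2, one_pow]
  calc _ = zetaVar z ^ (1 / 2 : ℂ) * exp (-(3 / 2) * δ * zetaVar z ^ 2) *
        ((3 : ℂ) ^ (1 / 4 : ℂ) * δ ^ k * momentCoeff δ (2 * m) k) * (δ * zetaVar z ^ 2) ^ k := by
        rw [mul_pow]
        linear_combination (-(zetaVar z ^ (1 / 2 : ℂ)) * exp (-(3 / 2) * δ * zetaVar z ^ 2) *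
          (3 : ℂ) ^ (1 / 4 : ℂ) * momentCoeff δ (2 * m) k * (zetaVar z ^ 2) ^ k) * hk
    _ = _ := by
        rw [h, Finset.mul_sum, Finset.sum_mul]
        exact Finset.sum_congr rfl fun j _ => by ring

/-! ### Integrability of cubic and quadratic exponentials -/

theorem eventually_cubic_le_neg {c : ℝ} (hc : 0 < c) (A B : ℝ) :
    ∀ᶠ r : ℝ in atTop, -c * r ^ 3 + A * r ^ 2 + B * r ≤ -r := by
  filter_upwards [eventually_ge_atTop (1 : ℝ), eventually_ge_atTop ((|A| + |B| + 1) / c)] with r h1 h2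
  have h3 : |A| + |B| + 1 ≤ c * r := by rwa [div_le_iff₀' hc] at h2
  have h4 : A * r ^ 2 ≤ |A| * r ^ 2 := mul_le_mul_of_nonneg_right (le_abs_self A) (by positivity)
  have h5 : B * r ≤ |B| * r ^ 2 := by
    calc B * r ≤ |B| * r := mul_le_mul_of_nonneg_right (le_abs_self B) (by linarith)
      _ ≤ |B| * r ^ 2 := mul_le_mul_of_nonneg_left (by nlinarith) (abs_nonneg B)
  have h6 : (|A| + |B| + 1) * r ^ 2 ≤ c * r * r ^ 2 :=
    mul_le_mul_of_nonneg_right h3 (by positivity)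
  nlinarith

open MeasureTheory in
theorem integrableOn_exp_cubic {c : ℝ} (hc : 0 < c) (A B : ℝ) :
    IntegrableOn (fun r : ℝ => Real.exp (-c * r ^ 3 + A * r ^ 2 + B * r)) (Set.Ioi 0) := by
  refine integrable_of_isBigO_exp_neg one_pos (by fun_prop) ?_
  refine IsBigO.of_bound 1 ?_
  filter_upwards [eventually_cubic_le_neg hc A B] with r h
  rw [Real.norm_of_nonneg (Real.exp_pos _).le, Real.norm_of_nonneg (Real.exp_pos _).le, one_mul,
    Real.exp_le_exp]
  linarith

open MeasureTheory in
theorem integrableOn_exp_quadratic {c : ℝ} (hc : 0 < c) (B : ℝ) :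
    IntegrableOn (fun r : ℝ => Real.exp (-c * r ^ 2 + B * r)) (Set.Ioi 0) := by
  refine integrable_of_isBigO_exp_neg one_pos (by fun_prop) ?_
  refine IsBigO.of_bound 1 ?_
  filter_upwards [eventually_ge_atTop (0 : ℝ), eventually_ge_atTop ((B + 1) / c)] with r h1 h2
  rw [Real.norm_of_nonneg (Real.exp_pos _).le, Real.norm_of_nonneg (Real.exp_pos _).le, one_mul,
    Real.exp_le_exp]
  have h3 : B + 1 ≤ c * r := by rwa [div_le_iff₀' hc] at h2
  nlinarith [mul_le_mul_of_nonneg_right h3 h1]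

open MeasureTheory in
theorem integrableOn_pow_mul_exp_quadratic {c : ℝ} (hc : 0 < c) (B : ℝ) (n : ℕ) :
    IntegrableOn (fun r : ℝ => r ^ n * Real.exp (-c * r ^ 2 + B * r)) (Set.Ioi 0) := by
  -- The power is absorbed by r^n ≤ n! e^r, whence B + 1.
  refine ((integrableOn_exp_quadratic hc (B + 1)).const_mul (n.factorial : ℝ)).mono'
    (by fun_prop) ?_
  filter_upwards [ae_restrict_mem measurableSet_Ioi] with r hr
  have hr' : 0 ≤ r := le_of_lt hr
  rw [Real.norm_of_nonneg (by positivity),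
    show -c * r ^ 2 + (B + 1) * r = r + (-c * r ^ 2 + B * r) by ring, Real.exp_add r, ← mul_assoc]
  refine mul_le_mul_of_nonneg_right ?_ (Real.exp_pos _).le
  have := Real.pow_div_factorial_le_exp r hr' n
  rwa [div_le_iff₀' (by positivity)] at this

/-! ### Airy functions as integrals along rays -/

/-- The moments `∫_0^∞ r^n e^{-r³/3} dr`. -/
noncomputable def cubicMoment (n : ℕ) : ℝ :=
  ∫ r in Set.Ioi (0 : ℝ), r ^ n * Real.exp (-(1 / 3) * r ^ 3)

theorem cubicMoment_eq_Gamma (n : ℕ) :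
    cubicMoment n = (1 / 3 : ℝ) ^ (-((n : ℝ) + 1) / 3) * (1 / 3) * Real.Gamma (((n : ℝ) + 1) / 3) := by
  have h := _root_.integral_rpow_mul_exp_neg_mul_rpow (p := 3) (q := n) (b := 1 / 3) (by norm_num)
    (by have : (0 : ℝ) ≤ n := n.cast_nonneg
        linarith) (by norm_num)
  rw [← h, cubicMoment]
  congr 1 with r
  rw [Real.rpow_natCast, show (3 : ℝ) = ((3 : ℕ) : ℝ) by norm_num, Real.rpow_natCast]

theorem cubicMoment_add_three (n : ℕ) : cubicMoment (n + 3) = ((n : ℝ) + 1) * cubicMoment n := by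
  have hn : (0 : ℝ) ≤ n := n.cast_nonneg
  rw [cubicMoment_eq_Gamma, cubicMoment_eq_Gamma]
  push_cast
  rw [show ((n : ℝ) + 3 + 1) / 3 = (n + 1) / 3 + 1 by ring,
    Real.Gamma_add_one (by positivity),
    show -((n : ℝ) + 3 + 1) / 3 = -(n + 1) / 3 + -1 by ring,
    Real.rpow_add (by norm_num), Real.rpow_neg_one]
  ring

theorem one_third_rpow_neg (y : ℝ) : (1 / 3 : ℝ) ^ (-y) = 3 ^ y := by
  rw [one_div, Real.inv_rpow (by norm_num), ← Real.rpow_neg (by norm_num), neg_neg]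

theorem Gamma_one_third_mul_Gamma_two_thirds :
    Real.Gamma (1 / 3) * Real.Gamma (2 / 3) = 2 * Real.pi / √3 := by
  have h := Real.Gamma_mul_Gamma_one_sub (1 / 3)
  rw [show (1 : ℝ) - 1 / 3 = 2 / 3 by norm_num, mul_one_div, Real.sin_pi_div_three] at h
  rw [h]
  field_simp

theorem cubicMoment_zero :
    cubicMoment 0 * Real.Gamma (2 / 3) = 3 ^ (-(2 / 3) : ℝ) * (2 * Real.pi / √3) := by
  rw [← Gamma_one_third_mul_Gamma_two_thirds, cubicMoment_eq_Gamma, Nat.cast_zero, zero_add,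
    neg_div, one_third_rpow_neg, show -(2 / 3 : ℝ) = 1 / 3 + -1 by norm_num,
    Real.rpow_add (by norm_num), Real.rpow_neg_one]
  ring

theorem cubicMoment_one :
    cubicMoment 1 * Real.Gamma (4 / 3) = 3 ^ (-(4 / 3) : ℝ) * (2 * Real.pi / √3) := by
  rw [← Gamma_one_third_mul_Gamma_two_thirds, cubicMoment_eq_Gamma, Nat.cast_one,
    show (4 / 3 : ℝ) = 1 / 3 + 1 by norm_num, Real.Gamma_add_one (by norm_num), neg_div,
    one_third_rpow_neg, show -(1 / 3 + 1 : ℝ) = (1 + 1) / 3 + (-2 : ℤ) by norm_num,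
    Real.rpow_add (by norm_num), Real.rpow_intCast, show ((1 : ℝ) + 1) / 3 = 2 / 3 by norm_num]
  norm_num
  ring

/-- By the three-step recursion the left side is divided by (3m+2)(3m+3) = 9(m+2/3)(m+1) when m
increases by one, which is exactly the ratio of consecutive denominators in `airyF`. The companion
for 3m + 1 has 9(m+4/3)(m+1) and matches `airyG`. -/
theorem cubicMoment_three_mul (m : ℕ) :
    ((cubicMoment (3 * m) : ℝ) : ℂ) / ((3 * m).factorial : ℂ) =
      ((cubicMoment 0 * Real.Gamma (2 / 3) : ℝ) : ℂ) /
        ((9 : ℂ) ^ m * (m.factorial : ℂ) * Complex.Gamma ((m : ℂ) + 2 / 3)) := by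
  have hG : ∀ m : ℕ, Complex.Gamma ((m : ℂ) + 2 / 3) ≠ 0 := fun m => by
    apply Complex.Gamma_ne_zero_of_re_pos
    have : (0 : ℝ) ≤ m := m.cast_nonneg
    simp
    positivity
  induction m with
  | zero =>
    have h := hG 0
    rw [ofReal_mul, ← Complex.Gamma_ofReal]
    push_cast at h ⊢
    rw [zero_add] at h ⊢
    field_simp
  | succ m ih =>
    have h1 : (m : ℂ) + 2 / 3 ≠ 0 := by
      intro h
      have := congrArg re h
      have h0 : (0 : ℝ) ≤ m := m.cast_nonneg
      norm_num at this
      linarith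
    have hGm := hG m
    have hf : (m.factorial : ℂ) ≠ 0 := by exact_mod_cast m.factorial_ne_zero
    have hf3 : ((3 * m).factorial : ℂ) ≠ 0 := by exact_mod_cast (3 * m).factorial_ne_zero
    have h2 : (m : ℂ) + 1 ≠ 0 := by exact_mod_cast m.succ_ne_zero
    have h31 : (3 : ℂ) * m + 1 ≠ 0 := by exact_mod_cast (3 * m).succ_ne_zero
    have h32 : (3 : ℂ) * m + 2 ≠ 0 := by exact_mod_cast (3 * m + 1).succ_ne_zero
    have h33 : (3 : ℂ) * m + 3 ≠ 0 := by exact_mod_cast (3 * m + 2).succ_ne_zero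
    rw [show 3 * (m + 1) = 3 * m + 3 by ring, cubicMoment_add_three, cast_factorial_add_three,
      Nat.factorial_succ m, Nat.cast_add_one m, show (m : ℂ) + 1 + 2 / 3 = m + 2 / 3 + 1 by ring,
      Complex.Gamma_add_one _ h1]
    rw [div_eq_iff hf3] at ih
    push_cast at ih ⊢
    rw [ih]
    field_simp
    ring

theorem cubicMoment_three_mul_add_one (m : ℕ) :
    ((cubicMoment (3 * m + 1) : ℝ) : ℂ) / ((3 * m + 1).factorial : ℂ) =
      ((cubicMoment 1 * Real.Gamma (4 / 3) : ℝ) : ℂ) /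
        ((9 : ℂ) ^ m * (m.factorial : ℂ) * Complex.Gamma ((m : ℂ) + 4 / 3)) := by
  have hG : ∀ m : ℕ, Complex.Gamma ((m : ℂ) + 4 / 3) ≠ 0 := fun m => by
    apply Complex.Gamma_ne_zero_of_re_pos
    have : (0 : ℝ) ≤ m := m.cast_nonneg
    simp
    positivity
  induction m with
  | zero =>
    have h := hG 0
    rw [ofReal_mul, ← Complex.Gamma_ofReal]
    push_cast at h ⊢
    rw [zero_add] at h ⊢
    field_simp
    simp
  | succ m ih =>
    have h1 : (m : ℂ) + 4 / 3 ≠ 0 := by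
      intro h
      have := congrArg re h
      have h0 : (0 : ℝ) ≤ m := m.cast_nonneg
      norm_num at this
      linarith
    have hGm := hG m
    have hf : (m.factorial : ℂ) ≠ 0 := by exact_mod_cast m.factorial_ne_zero
    have hf3 : ((3 * m + 1).factorial : ℂ) ≠ 0 := by exact_mod_cast (3 * m + 1).factorial_ne_zero
    have h2 : (m : ℂ) + 1 ≠ 0 := by exact_mod_cast m.succ_ne_zero
    have h31 : (3 : ℂ) * m + 1 + 1 ≠ 0 := by exact_mod_cast (3 * m + 1).succ_ne_zero
    have h32 : (3 : ℂ) * m + 1 + 2 ≠ 0 := by exact_mod_cast (3 * m + 2).succ_ne_zero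
    have h33 : (3 : ℂ) * m + 1 + 3 ≠ 0 := by exact_mod_cast (3 * m + 3).succ_ne_zero
    rw [show 3 * (m + 1) + 1 = 3 * m + 1 + 3 by ring, cubicMoment_add_three,
      cast_factorial_add_three,
      Nat.factorial_succ m, Nat.cast_add_one m, show (m : ℂ) + 1 + 4 / 3 = m + 4 / 3 + 1 by ring,
      Complex.Gamma_add_one _ h1]
    rw [div_eq_iff hf3] at ih
    push_cast at ih ⊢
    rw [ih]
    have h1' : 3 * (m : ℂ) + 4 ≠ 0 := fun h => h1 (by linear_combination h / 3)
    field_simp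
    ring

/-- The integral of `exp(s³/3 - ts)` along the ray from `0` in the direction `ω`, `ω³ = -1`. -/
noncomputable def airyRay (ω t : ℂ) : ℂ :=
  ω * ∫ r in Set.Ioi (0 : ℝ), exp (-(1 / 3) * (r : ℂ) ^ 3 - t * ω * r)

-- Expansion of exp(-tωr) under the integral sign, dominated by e^{-r³/3 + |tω|r}.
open MeasureTheory in
theorem hasSum_airyRay (ω t : ℂ) :
    HasSum (fun n : ℕ => ω ^ (n + 1) * (-t) ^ n * ((cubicMoment n : ℂ) / (n.factorial : ℂ)))
      (airyRay ω t) := by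
  have key : HasSum (fun n : ℕ => ∫ r in Set.Ioi (0 : ℝ),
      (exp (-(1 / 3) * (r : ℂ) ^ 3) * ((-(t * ω * r)) ^ n / (n.factorial : ℂ))))
      (∫ r in Set.Ioi (0 : ℝ), exp (-(1 / 3) * (r : ℂ) ^ 3 - t * ω * r)) := by
    refine hasSum_integral_of_dominated_convergence
      (fun n r => Real.exp (-(1 / 3) * r ^ 3) * ((‖t * ω‖ * r) ^ n / n.factorial))
      (fun n => (by fun_prop : Continuous _).aestronglyMeasurable) (fun n => ?_) ?_ ?_ ?_
    · filter_upwards [ae_restrict_mem measurableSet_Ioi] with r hr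
      have hr' : 0 ≤ r := le_of_lt hr
      rw [norm_mul, norm_exp, norm_div, norm_pow, norm_neg, norm_mul (t * ω), norm_natCast,
        norm_real, Real.norm_of_nonneg hr']
      have : (-(1 / 3) * (r : ℂ) ^ 3).re = -(1 / 3) * r ^ 3 := by
        rw [show (-(1 / 3) * (r : ℂ) ^ 3) = ((-(1 / 3) * r ^ 3 : ℝ) : ℂ) by push_cast; rfl,
          ofReal_re]
      rw [this]
    · exact .of_forall fun r => (Real.summable_pow_div_factorial _).mul_left _
    · have : (fun r : ℝ => ∑' n : ℕ, Real.exp (-(1 / 3) * r ^ 3) *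
          ((‖t * ω‖ * r) ^ n / n.factorial)) =
          fun r => Real.exp (-(1 / 3) * r ^ 3 + 0 * r ^ 2 + ‖t * ω‖ * r) := by
        funext r
        rw [tsum_mul_left, Real.exp_add, zero_mul, add_zero, Real.exp_eq_exp_ℝ,
          NormedSpace.exp_eq_tsum_div]
      rw [this]
      exact integrableOn_exp_cubic (by norm_num) _ _
    · refine .of_forall fun r => ?_
      rw [sub_eq_add_neg, exp_add]
      refine HasSum.mul_left _ ?_
      rw [exp_eq_exp_ℂ]
      exact NormedSpace.expSeries_div_hasSum_exp _
  have hg : ∀ n : ℕ, ∫ r in Set.Ioi (0 : ℝ),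
      (exp (-(1 / 3) * (r : ℂ) ^ 3) * ((-(t * ω * r)) ^ n / (n.factorial : ℂ))) =
      (-(t * ω)) ^ n / n.factorial * (cubicMoment n : ℂ) := by
    intro n
    rw [cubicMoment, ← integral_complex_ofReal, ← integral_const_mul]
    congr 1 with r
    push_cast
    ring
  have h := key.mul_left ω
  simp only [hg] at h
  rw [airyRay]
  have hn : ∀ n : ℕ, ω ^ (n + 1) * (-t) ^ n * ((cubicMoment n : ℂ) / (n.factorial : ℂ)) =
      ω * ((-(t * ω)) ^ n / n.factorial * (cubicMoment n : ℂ)) := fun n => by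
    rw [← neg_mul, mul_pow]
    ring
  simpa only [hn] using h

/-- The power series is split by the residue of n modulo 3. The class n ≡ 2 carries ω^{3m+3}, a
power of ω³ = -1, so its sum does not depend on ω and drops out of every combination of rays whose
coefficients sum to zero. -/
theorem airyRay_eq_airyF_airyG {ω : ℂ} (hω : ω ^ 3 = -1) (t : ℂ) :
    airyRay ω t = ω * ((cubicMoment 0 * Real.Gamma (2 / 3) : ℝ) : ℂ) * airyF t
      - ω ^ 2 * ((cubicMoment 1 * Real.Gamma (4 / 3) : ℝ) : ℂ) * airyG t
      - ∑' m : ℕ, (-1) ^ m * (-t) ^ (3 * m + 2) *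
          ((cubicMoment (3 * m + 2) : ℂ) / ((3 * m + 2).factorial : ℂ)) := by
  have h := hasSum_airyRay ω t
  have hp : ∀ m, ω ^ (3 * m) = (-1) ^ m := fun m => by rw [pow_mul, hω]
  have hm : ∀ m : ℕ, ((-1 : ℂ)) ^ (m * 3) = (-1) ^ m := fun m => by
    rw [mul_comm, pow_mul]; norm_num
  have hm2 : ∀ m : ℕ, ((-1 : ℂ)) ^ m * (-1) ^ m = 1 := fun m => by
    rw [← mul_pow]; norm_num
  rw [← h.tsum_eq, Nat.sumByResidueClasses h.summable 3]
  change ∑ j : Fin 3, ∑' m, ω ^ ((j : ℕ) + 3 * m + 1) * (-t) ^ ((j : ℕ) + 3 * m) *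
    ((cubicMoment ((j : ℕ) + 3 * m) : ℂ) / (((j : ℕ) + 3 * m).factorial : ℂ)) = _
  rw [Fin.sum_univ_three]
  have h0 : ∀ m : ℕ, ω ^ (0 + 3 * m + 1) * (-t) ^ (0 + 3 * m) *
      ((cubicMoment (0 + 3 * m) : ℂ) / ((0 + 3 * m).factorial : ℂ)) =
      ω * ((cubicMoment 0 * Real.Gamma (2 / 3) : ℝ) : ℂ) * (t ^ (3 * m) /
        ((9 : ℂ) ^ m * (m.factorial : ℂ) * Complex.Gamma ((m : ℂ) + 2 / 3))) := by
    intro m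
    rw [zero_add, cubicMoment_three_mul, pow_succ, hp, neg_pow t, mul_comm 3 m, hm]
    linear_combination (t ^ (m * 3) * ω * (((cubicMoment 0 * Real.Gamma (2 / 3) : ℝ) : ℂ) /
        ((9 : ℂ) ^ m * (m.factorial : ℂ) * Complex.Gamma ((m : ℂ) + 2 / 3)))) * hm2 m
  have h1 : ∀ m : ℕ, ω ^ (1 + 3 * m + 1) * (-t) ^ (1 + 3 * m) *
      ((cubicMoment (1 + 3 * m) : ℂ) / ((1 + 3 * m).factorial : ℂ)) =
      -(ω ^ 2 * ((cubicMoment 1 * Real.Gamma (4 / 3) : ℝ) : ℂ)) * (t ^ (3 * m + 1) /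
        ((9 : ℂ) ^ m * (m.factorial : ℂ) * Complex.Gamma ((m : ℂ) + 4 / 3))) := by
    intro m
    rw [show 1 + 3 * m + 1 = 3 * m + 2 by ring, show 1 + 3 * m = 3 * m + 1 by ring,
      cubicMoment_three_mul_add_one, pow_add, hp, neg_pow t, pow_succ (-1 : ℂ) (3 * m),
      mul_comm 3 m, hm]
    linear_combination (-t ^ (m * 3 + 1) * ω ^ 2 *
      (((cubicMoment 1 * Real.Gamma (4 / 3) : ℝ) : ℂ) /
        ((9 : ℂ) ^ m * (m.factorial : ℂ) * Complex.Gamma ((m : ℂ) + 4 / 3)))) * hm2 m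
  have h2 : ∀ m : ℕ, ω ^ (2 + 3 * m + 1) * (-t) ^ (2 + 3 * m) *
      ((cubicMoment (2 + 3 * m) : ℂ) / ((2 + 3 * m).factorial : ℂ)) =
      -((-1) ^ m * (-t) ^ (3 * m + 2) *
          ((cubicMoment (3 * m + 2) : ℂ) / ((3 * m + 2).factorial : ℂ))) := by
    intro m
    rw [show 2 + 3 * m + 1 = 3 * m + 3 by ring, show 2 + 3 * m = 3 * m + 2 by ring, pow_add, hp, hω]
    ring
  have e0 : ((0 : Fin 3) : ℕ) = 0 := rfl
  have e1 : ((1 : Fin 3) : ℕ) = 1 := rfl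
  have e2 : ((2 : Fin 3) : ℕ) = 2 := rfl
  rw [e0, e1, e2, tsum_congr h0, tsum_congr h1, tsum_congr h2, tsum_mul_left, tsum_mul_left,
    tsum_neg, airyF, airyG]
  ring

theorem exp_pi_div_three : exp ((Real.pi / 3 : ℝ) * I) = 1 / 2 + (√3 / 2 : ℝ) * I := by
  rw [exp_mul_I, ← ofReal_cos, ← ofReal_sin, Real.cos_pi_div_three, Real.sin_pi_div_three]
  push_cast
  ring

theorem exp_neg_pi_div_three : exp ((-(Real.pi / 3) : ℝ) * I) = 1 / 2 - (√3 / 2 : ℝ) * I := by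
  rw [exp_mul_I, ← ofReal_cos, ← ofReal_sin, Real.cos_neg, Real.sin_neg, Real.cos_pi_div_three,
    Real.sin_pi_div_three]
  push_cast
  ring

theorem ofReal_sqrt_three_sq : ((√3 : ℝ) : ℂ) ^ 2 = 3 := by
  rw [← ofReal_pow, Real.sq_sqrt (by norm_num)]
  norm_num

theorem ofReal_sqrt_three_ne_zero : ((√3 : ℝ) : ℂ) ≠ 0 := by
  rw [ofReal_ne_zero]
  positivity

theorem exp_pi_div_three_cube : exp ((Real.pi / 3 : ℝ) * I) ^ 3 = -1 := by
  rw [← exp_nat_mul, ← exp_pi_mul_I]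
  congr 1
  push_cast
  ring

theorem exp_neg_pi_div_three_cube : exp ((-(Real.pi / 3) : ℝ) * I) ^ 3 = -1 := by
  rw [← exp_nat_mul, ← exp_neg_pi_mul_I]
  congr 1
  push_cast
  ring

theorem ofReal_cubicMoment_zero : ((cubicMoment 0 * Real.Gamma (2 / 3) : ℝ) : ℂ) =
    3 ^ (-(2 / 3) : ℂ) * (2 * Real.pi / (√3 : ℝ)) := by
  rw [cubicMoment_zero, ofReal_mul, ofReal_cpow (by norm_num)]
  push_cast
  rfl

theorem ofReal_cubicMoment_one : ((cubicMoment 1 * Real.Gamma (4 / 3) : ℝ) : ℂ) =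
    3 ^ (-(4 / 3) : ℂ) * (2 * Real.pi / (√3 : ℝ)) := by
  rw [cubicMoment_one, ofReal_mul, ofReal_cpow (by norm_num)]
  push_cast
  rfl

/-- `Ai` as a contour integral from `e^{-iπ/3}∞` to `e^{iπ/3}∞`. -/
theorem airyAi_eq_airyRay (t : ℂ) :
    airyAi t = (airyRay (exp ((Real.pi / 3 : ℝ) * I)) t
      - airyRay (exp ((-(Real.pi / 3) : ℝ) * I)) t) / (2 * Real.pi * I) := by
  rw [airyRay_eq_airyF_airyG exp_pi_div_three_cube, airyRay_eq_airyF_airyG exp_neg_pi_div_three_cube,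
    airyAi, exp_pi_div_three, exp_neg_pi_div_three, ofReal_cubicMoment_zero, ofReal_cubicMoment_one]
  have h3 := ofReal_sqrt_three_ne_zero
  have hp : (Real.pi : ℂ) ≠ 0 := ofReal_ne_zero.mpr Real.pi_ne_zero
  push_cast
  field_simp
  ring

/-- `Bi` as a mean of two contour integrals from `-∞` to `e^{±iπ/3}∞`. -/
theorem airyBi_eq_airyRay (t : ℂ) :
    airyBi t = (airyRay (exp ((Real.pi / 3 : ℝ) * I)) t
      + airyRay (exp ((-(Real.pi / 3) : ℝ) * I)) t - 2 * airyRay (-1) t) / (2 * Real.pi) := by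
  rw [airyRay_eq_airyF_airyG exp_pi_div_three_cube, airyRay_eq_airyF_airyG exp_neg_pi_div_three_cube,
    airyRay_eq_airyF_airyG (by norm_num),
    airyBi, exp_pi_div_three, exp_neg_pi_div_three, ofReal_cubicMoment_zero, ofReal_cubicMoment_one]
  have h3 := ofReal_sqrt_three_ne_zero
  have hp : (Real.pi : ℂ) ≠ 0 := ofReal_ne_zero.mpr Real.pi_ne_zero
  have hs : ((√3 : ℝ) : ℂ) = 3 ^ (1 / 2 : ℂ) := by
    rw [Real.sqrt_eq_rpow, ofReal_cpow (by norm_num)]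
    push_cast
    rfl
  have e1 : (3 : ℂ) ^ (-(1 / 6) : ℂ) = 3 ^ (-(2 / 3) : ℂ) * (√3 : ℝ) := by
    rw [hs, ← cpow_add _ _ (by norm_num)]
    norm_num
  have e2 : (3 : ℂ) ^ (-(5 / 6) : ℂ) = 3 ^ (-(4 / 3) : ℂ) * (√3 : ℝ) := by
    rw [hs, ← cpow_add _ _ (by norm_num)]
    norm_num
  have hsq := ofReal_sqrt_three_sq
  rw [e1, e2]
  push_cast
  field_simp
  ring_nf
  simp only [I_sq, hsq]
  ring

/-! ### Deformation of the contours -/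

/-- The integrand of the Airy contour integrals. -/
noncomputable def airyKernel (t s : ℂ) : ℂ := exp (1 / 3 * s ^ 3 - t * s)

/-- Only the leading term R³Ω³/3 needs its sign; all others are bounded by their norms. The bound is
uniform in P and Ω, so it serves both a single ray and a whole segment joining two rays. -/
theorem norm_airyKernel_le {t P Ω : ℂ} {M q c R : ℝ} (hΩ : ‖Ω‖ ≤ M) (hP : ‖P‖ ≤ q)
    (hc : (Ω ^ 3).re ≤ -c) (hR : 0 ≤ R) :
    ‖airyKernel t (P + Ω * R)‖ ≤ Real.exp (-(c / 3) * R ^ 3 + M ^ 2 * q * R ^ 2 +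
      (M * q ^ 2 + ‖t‖ * M) * R + (q ^ 3 / 3 + ‖t‖ * q)) := by
  have hM : 0 ≤ M := (norm_nonneg _).trans hΩ
  have hq : 0 ≤ q := (norm_nonneg _).trans hP
  rw [airyKernel, norm_exp, Real.exp_le_exp]
  have e : 1 / 3 * (P + Ω * R) ^ 3 - t * (P + Ω * R) =
      ((R ^ 3 / 3 : ℝ) : ℂ) * Ω ^ 3 + (Ω ^ 2 * P * (R : ℂ) ^ 2 + Ω * P ^ 2 * R + P ^ 3 * (1 / 3 : ℝ)
        - t * P - t * Ω * R) := by
    push_cast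
    ring
  rw [e, add_re, re_ofReal_mul]
  have hR' : ‖(R : ℂ)‖ = R := by rw [norm_real, Real.norm_of_nonneg hR]
  have h2 : ‖Ω ^ 2 * P * (R : ℂ) ^ 2 + Ω * P ^ 2 * R + P ^ 3 * (1 / 3 : ℝ) - t * P - t * Ω * R‖ ≤
      M ^ 2 * q * R ^ 2 + M * q ^ 2 * R + q ^ 3 * (1 / 3) + ‖t‖ * q + ‖t‖ * M * R := by
    refine (norm_sub_le _ _).trans (add_le_add ((norm_sub_le _ _).trans (add_le_add
      (norm_add₃_le.trans (add_le_add_three ?_ ?_ ?_)) ?_)) ?_)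
    · rw [norm_mul, norm_mul, norm_pow, norm_pow, hR']
      gcongr
    · rw [norm_mul, norm_mul, norm_pow, hR']
      gcongr
    · rw [norm_mul, norm_pow, norm_real, Real.norm_of_nonneg (by norm_num)]
      gcongr
    · rw [norm_mul]
      gcongr
    · rw [norm_mul, norm_mul, hR']
      gcongr
  have h3 := (re_le_norm _).trans h2
  have h4 : R ^ 3 / 3 * (Ω ^ 3).re ≤ R ^ 3 / 3 * -c :=
    mul_le_mul_of_nonneg_left hc (by positivity)
  linarith

theorem continuous_airyKernel (t : ℂ) : Continuous (airyKernel t) := by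
  unfold airyKernel
  fun_prop

open MeasureTheory in
theorem integrableOn_airyKernel {Ω : ℂ} (hΩ : (Ω ^ 3).re < 0) (t p : ℂ) :
    IntegrableOn (fun r : ℝ => airyKernel t (p + Ω * r)) (Set.Ioi 0) := by
  have hi := (integrableOn_exp_cubic (c := -(Ω ^ 3).re / 3) (by linarith) (‖Ω‖ ^ 2 * ‖p‖)
    (‖Ω‖ * ‖p‖ ^ 2 + ‖t‖ * ‖Ω‖)).mul_const (Real.exp (‖p‖ ^ 3 / 3 + ‖t‖ * ‖p‖))
  refine hi.mono' ((continuous_airyKernel t).comp (by fun_prop)).aestronglyMeasurable ?_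
  filter_upwards [ae_restrict_mem measurableSet_Ioi] with r hr
  rw [← Real.exp_add]
  exact norm_airyKernel_le le_rfl le_rfl (by linarith) (le_of_lt hr)

-- Contours are compared through a primitive of the entire integrand: the integral along a ray is
-- the limit of the primitive minus its initial value.
open MeasureTheory in
theorem tendsto_primitive_airyKernel {t : ℂ} {F : ℂ → ℂ}
    (hF : ∀ s, HasDerivAt F (airyKernel t s) s) {Ω : ℂ} (hΩ : (Ω ^ 3).re < 0) (p : ℂ) :
    Tendsto (fun R : ℝ => F (p + Ω * R)) atTop
      (𝓝 (F p + Ω * ∫ r in Set.Ioi (0 : ℝ), airyKernel t (p + Ω * r))) := by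
  have h := (intervalIntegral_tendsto_integral_Ioi 0
    (((integrableOn_airyKernel hΩ t p).const_mul Ω)) tendsto_id)
  rw [integral_const_mul] at h
  refine (h.const_add (F p)).congr fun R => ?_
  rw [intervalIntegral.integral_eq_sub_of_hasDerivAt (f := fun r : ℝ => F (p + Ω * r))]
  · simp
  · intro x _
    have h1 : HasDerivAt (fun r : ℂ => p + Ω * r) Ω (x : ℂ) := by
      simpa using ((hasDerivAt_id (x : ℂ)).const_mul Ω).const_add p
    have h2 := ((hF (p + Ω * x)).comp (x : ℂ) h1).comp_ofReal
    simpa [mul_comm] using h2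
  · exact (continuous_const.mul ((continuous_airyKernel t).comp (by fun_prop))).intervalIntegrable _ _

/-- With σ = a + ib, Re σ³ = a(a - √3|b|)(a + √3|b|), and each factor is at least d. -/
theorem re_cube_ge {σ : ℂ} {d : ℝ} (hd : 0 ≤ d) (h : d ≤ σ.re - √3 * |σ.im|) :
    d ^ 3 ≤ (σ ^ 3).re := by
  have h3 : √3 ^ 2 = 3 := Real.sq_sqrt (by norm_num)
  have hb : 0 ≤ √3 * |σ.im| := by positivity
  have e : (σ ^ 3).re = σ.re * ((σ.re - √3 * |σ.im|) * (σ.re + √3 * |σ.im|)) := by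
    have : (σ.re - √3 * |σ.im|) * (σ.re + √3 * |σ.im|) = σ.re ^ 2 - 3 * σ.im ^ 2 := by
      linear_combination (-|σ.im| ^ 2) * h3 - 3 * sq_abs σ.im
    rw [this, pow_succ, sq]
    simp only [mul_re, mul_im]
    ring
  rw [e, show d ^ 3 = d * (d * d) by ring]
  have h1 : d ≤ σ.re := by linarith
  have h2 : d ≤ σ.re + √3 * |σ.im| := by linarith
  exact mul_le_mul h1 (mul_le_mul h h2 hd (hd.trans h)) (mul_nonneg hd hd) (hd.trans h1)

/-- Rotation and translation of an Airy contour integral: the ray from `0` in the direction `ω`,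
`ω³ = -1`, may be replaced by a ray from `p` in a direction `ωρ` with `|arg ρ| < π/6`, up to the
integral from `0` to `p`. -/
theorem airyRay_eq_shift {t : ℂ} {F : ℂ → ℂ} (hF : ∀ s, HasDerivAt F (airyKernel t s) s)
    {ω ρ : ℂ} (hω : ω ^ 3 = -1) (hρ : √3 * |ρ.im| < ρ.re) (p : ℂ) :
    airyRay ω t = (F p - F 0) + ω * ρ * ∫ r in Set.Ioi (0 : ℝ), airyKernel t (p + ω * ρ * r) := by
  set d : ℝ := min 1 (ρ.re - √3 * |ρ.im|) with hd
  have hd0 : 0 < d := lt_min one_pos (by linarith)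
  have hcube : ∀ σ : ℂ, ((ω * σ) ^ 3).re = -(σ ^ 3).re := fun σ => by
    rw [mul_pow, hω, neg_one_mul, neg_re]
  have hωn : ‖ω‖ = 1 := by
    have : ‖ω‖ ^ 3 = 1 := by rw [← norm_pow, hω, norm_neg, norm_one]
    exact (pow_eq_one_iff_of_nonneg (norm_nonneg _) (by norm_num)).mp this
  -- The segment from 1 to ρ stays in the convex sector |arg| < π/6; the concave function Re -
  -- √3|Im| is at least the minimum d of its values at the endpoints or of 1.
  have hσ : ∀ τ ∈ Set.Icc (0 : ℝ) 1, d ^ 3 ≤ (((1 : ℂ) + τ * (ρ - 1)) ^ 3).re := by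
    intro τ hτ
    refine re_cube_ge hd0.le ?_
    have e1 : ((1 : ℂ) + τ * (ρ - 1)).re = (1 - τ) + τ * ρ.re := by simp; ring
    have e2 : ((1 : ℂ) + τ * (ρ - 1)).im = τ * ρ.im := by simp
    rw [e1, e2, abs_mul, abs_of_nonneg hτ.1]
    have h1 : (1 - τ) * d ≤ (1 - τ) * 1 :=
      mul_le_mul_of_nonneg_left (min_le_left _ _) (by linarith [hτ.2])
    have h2 : τ * d ≤ τ * (ρ.re - √3 * |ρ.im|) :=
      mul_le_mul_of_nonneg_left (min_le_right _ _) hτ.1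
    linarith
  have hρ3 : ((ω * ρ) ^ 3).re < 0 := by
    have := hσ 1 ⟨zero_le_one, le_rfl⟩
    rw [hcube]
    simp only [ofReal_one, one_mul, add_sub_cancel] at this
    have : 0 < d ^ 3 := by positivity
    linarith
  have hω3 : (ω ^ 3).re < 0 := by rw [hω]; simp
  have hlim := (tendsto_primitive_airyKernel hF hρ3 p).sub
    (tendsto_primitive_airyKernel hF hω3 0)
  -- The far ends of the two rays are joined by a segment of length O(R) on which the integrand is
  -- bounded by an exponential with leading term -d³R³/3, so the primitive takes the same limit
  -- along both.
  have hzero : Tendsto (fun R : ℝ => F (p + ω * ρ * R) - F (0 + ω * R)) atTop (𝓝 0) := by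
    set M : ℝ := 1 + ‖ρ - 1‖ with hM
    have hM0 : 0 ≤ M := by positivity
    set C : ℝ := ‖p‖ ^ 3 / 3 + ‖t‖ * ‖p‖ with hC
    set A : ℝ := M ^ 2 * ‖p‖ with hA
    set B : ℝ := M * ‖p‖ ^ 2 + ‖t‖ * M with hB
    refine squeeze_zero_norm' (a := fun R => Real.exp (C + ‖p‖) * Real.exp (-R)) ?_ ?_
    · filter_upwards [eventually_cubic_le_neg (c := d ^ 3 / 3) (by positivity) A (B + M),
        eventually_ge_atTop (0 : ℝ)] with R hR hR0
      have hmv := Convex.norm_image_sub_le_of_norm_hasDerivWithin_le (𝕜 := ℝ)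
        (f := fun τ : ℝ => F (τ * p + ω * (1 + τ * (ρ - 1)) * R))
        (f' := fun τ : ℝ => airyKernel t (τ * p + ω * (1 + τ * (ρ - 1)) * R) *
          (p + ω * (ρ - 1) * R)) (s := Set.Icc 0 1) (x := 0) (y := 1)
        (C := Real.exp (-(d ^ 3 / 3) * R ^ 3 + A * R ^ 2 + B * R + C) * (‖p‖ + M * R))
        ?_ ?_ (convex_Icc 0 1) (by simp) (by simp)
      · simp only [ofReal_one, one_mul, ofReal_zero, zero_mul, add_zero, add_sub_cancel, mul_one,
          sub_zero, norm_one, zero_add] at hmv ⊢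
        refine hmv.trans ?_
        have h1 : ‖p‖ + M * R ≤ Real.exp (‖p‖ + M * R) := by
          linarith [Real.add_one_le_exp (‖p‖ + M * R)]
        refine (mul_le_mul_of_nonneg_left h1 (Real.exp_pos _).le).trans ?_
        rw [← Real.exp_add, ← Real.exp_add, Real.exp_le_exp]
        linarith
      · intro τ _
        have h1 : HasDerivAt (fun τ : ℂ => τ * p + ω * (1 + τ * (ρ - 1)) * R)
            (p + ω * (ρ - 1) * R) (τ : ℂ) := by
          have := ((hasDerivAt_id (τ : ℂ)).mul_const p).add
            (((((hasDerivAt_id (τ : ℂ)).mul_const (ρ - 1)).const_add 1).const_mul ω).mul_const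
              (R : ℂ))
          refine HasDerivAt.congr_deriv this ?_
          ring
        exact ((hF _).comp (τ : ℂ) h1).comp_ofReal.hasDerivWithinAt
      · intro τ hτ
        rw [norm_mul]
        have hτn : ‖(τ : ℂ)‖ ≤ 1 := by
          rw [norm_real, Real.norm_of_nonneg hτ.1]; exact hτ.2
        refine mul_le_mul (norm_airyKernel_le ?_ ?_ ?_ hR0) ?_ (norm_nonneg _) (Real.exp_pos _).le
        · rw [norm_mul, hωn, one_mul]
          refine (norm_add_le _ _).trans ?_
          rw [norm_one, norm_mul]
          exact add_le_add le_rfl (mul_le_of_le_one_left (norm_nonneg _) hτn)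
        · rw [norm_mul]
          exact mul_le_of_le_one_left (norm_nonneg _) hτn
        · rw [hcube]
          exact neg_le_neg (hσ τ hτ)
        · refine (norm_add_le _ _).trans ?_
          rw [norm_mul, norm_mul, hωn, one_mul, norm_real, Real.norm_of_nonneg hR0]
          gcongr
          linarith
    · rw [show (0 : ℝ) = Real.exp (C + ‖p‖) * 0 by ring]
      exact (Real.tendsto_exp_neg_atTop_nhds_zero).const_mul _
  have h := tendsto_nhds_unique hlim hzero
  have hr : airyRay ω t = ω * ∫ r in Set.Ioi (0 : ℝ), airyKernel t (0 + ω * r) := by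
    rw [airyRay]
    congr 2 with r
    rw [airyKernel]
    congr 1
    rw [zero_add, mul_pow, hω]
    ring
  rw [hr]
  linear_combination -h

theorem exists_primitive_airyKernel (t : ℂ) :
    ∃ F : ℂ → ℂ, ∀ s, HasDerivAt F (airyKernel t s) s := by
  have hd : Differentiable ℂ (airyKernel t) := by
    unfold airyKernel
    fun_prop
  obtain ⟨F, hF⟩ := hd.isExactOn_univ
  exact ⟨F, fun s => hF s (Set.mem_univ s)⟩

/-! ### Expansion of Gaussian ray integrals -/

/-- Taylor's formula for the exponential, with a remainder that only involves the real part. -/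
theorem norm_exp_sub_sum_le_max (w : ℂ) (n : ℕ) :
    ‖exp w - ∑ k ∈ Finset.range n, w ^ k / (k.factorial : ℂ)‖ ≤ ‖w‖ ^ n * max 1 (Real.exp w.re) := by
  induction n generalizing w with
  | zero => simp [norm_exp]
  | succ n ih =>
    have hderiv : ∀ s : ℝ, HasDerivAt
        (fun s : ℝ => exp (s * w) - ∑ k ∈ Finset.range (n + 1), (s * w) ^ k / (k.factorial : ℂ))
        ((exp (s * w) - ∑ k ∈ Finset.range n, (s * w) ^ k / (k.factorial : ℂ)) * w) s := by
      intro s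
      have h1 : HasDerivAt (fun s : ℂ => s * w) w (s : ℂ) := by
        simpa using (hasDerivAt_id (s : ℂ)).mul_const w
      have h2 : HasDerivAt
          (fun s : ℂ => exp (s * w) - ∑ k ∈ Finset.range (n + 1), (s * w) ^ k / (k.factorial : ℂ))
          (exp (s * w) * w - ∑ k ∈ Finset.range (n + 1),
            ((k : ℂ) * (s * w) ^ (k - 1) * w) / (k.factorial : ℂ)) (s : ℂ) :=
        h1.cexp.sub (HasDerivAt.fun_sum fun k _ => (h1.pow k).div_const _)
      refine (h2.comp_ofReal).congr_deriv ?_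
      rw [Finset.sum_range_succ', sub_mul, Finset.sum_mul]
      simp only [Nat.cast_zero, zero_mul, zero_div, add_zero]
      congr 1
      refine Finset.sum_congr rfl fun k _ => ?_
      have hk : (k.factorial : ℂ) ≠ 0 := by exact_mod_cast k.factorial_ne_zero
      have hk1 : (k : ℂ) + 1 ≠ 0 := by exact_mod_cast k.succ_ne_zero
      rw [Nat.factorial_succ, Nat.add_sub_cancel]
      push_cast
      field_simp
    -- Mean value inequality along s ↦ sw: the derivative is w times the remainder of order n at sw,
    -- and e^{s Re w} ≤ max(1, e^{Re w}) for s in [0, 1].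
    have hmv := Convex.norm_image_sub_le_of_norm_hasDerivWithin_le (𝕜 := ℝ) (s := Set.Icc 0 1)
      (x := 0) (y := 1) (C := ‖w‖ ^ (n + 1) * max 1 (Real.exp w.re))
      (fun s _ => (hderiv s).hasDerivWithinAt) ?_ (convex_Icc 0 1) (by simp) (by simp)
    · have h0 : ∑ k ∈ Finset.range (n + 1), (0 : ℂ) ^ k / (k.factorial : ℂ) = 1 := by
        rw [Finset.sum_range_succ']
        simp
      simpa [h0] using hmv
    · intro s hs
      rw [norm_mul, pow_succ, mul_right_comm]
      refine mul_le_mul_of_nonneg_right ((ih _).trans ?_) (norm_nonneg _)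
      have hre : ((s : ℂ) * w).re = s * w.re := re_ofReal_mul s w
      rw [hre, norm_mul, norm_real, Real.norm_of_nonneg hs.1]
      refine mul_le_mul (pow_le_pow_left₀ (by have := hs.1; positivity)
        (mul_le_of_le_one_left (norm_nonneg _) hs.2) n) ?_ (by positivity) (by positivity)
      refine max_le (le_max_left _ _) ?_
      rcases le_total 0 w.re with h | h
      · exact (Real.exp_le_exp.mpr (mul_le_of_le_one_left h hs.2)).trans (le_max_right _ _)
      · refine le_trans ?_ (le_max_left _ _)
        rw [Real.exp_le_one_iff]
        exact mul_nonpos_of_nonneg_of_nonpos hs.1 h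

/-- The Gaussian weight `e^{3δv²/2}` on the ray in the direction `ω`. -/
noncomputable def gaussWeight (δ ω : ℂ) (r : ℝ) : ℂ := exp (3 / 2 * δ * ω ^ 2 * (r : ℂ) ^ 2)

/-- The integral of `exp(3δv²/2 + μ(v³ - 3xv))` along the ray from `0` in the direction `ω`. -/
noncomputable def gaussRay (δ ω x μ : ℂ) : ℂ :=
  ω * ∫ r in Set.Ioi (0 : ℝ),
    gaussWeight δ ω r * exp (μ * ((ω * r) ^ 3 - 3 * x * (ω * r)))

/-- The integral of `v^n exp(3δv²/2)` along the ray from `0` in the direction `ω`. -/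
noncomputable def gaussRayMoment (δ ω : ℂ) (n : ℕ) : ℂ :=
  ω * ∫ r in Set.Ioi (0 : ℝ), gaussWeight δ ω r * (ω * r) ^ n

/-- The `μ^j`-coefficient of a functional with moments `E n`, applied to `exp(μ(v³ - 3xv))`. -/
noncomputable def expMoment (E : ℕ → ℂ) (x : ℂ) (j : ℕ) : ℂ :=
  ∑ k ∈ Finset.range (j + 1),
    (-3) ^ k * E (3 * j - 2 * k) / ((k.factorial : ℂ) * ((j - k).factorial : ℂ)) * x ^ k

theorem norm_gaussWeight (δ ω : ℂ) (r : ℝ) :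
    ‖gaussWeight δ ω r‖ = Real.exp (-(-(3 / 2) * (δ * ω ^ 2).re) * r ^ 2) := by
  rw [gaussWeight, norm_exp]
  congr 1
  rw [show 3 / 2 * δ * ω ^ 2 * (r : ℂ) ^ 2 = ((3 / 2 * r ^ 2 : ℝ) : ℂ) * (δ * ω ^ 2) by
    push_cast; ring, re_ofReal_mul]
  ring

theorem continuous_gaussWeight (δ ω : ℂ) : Continuous (gaussWeight δ ω) := by
  unfold gaussWeight
  fun_prop

theorem hasDerivAt_gaussWeight (δ ω : ℂ) (r : ℝ) :
    HasDerivAt (gaussWeight δ ω) (3 * δ * ω ^ 2 * r * gaussWeight δ ω r) r := by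
  have h : HasDerivAt (fun r : ℂ => exp (3 / 2 * δ * ω ^ 2 * r ^ 2))
      (exp (3 / 2 * δ * ω ^ 2 * r ^ 2) * (3 / 2 * δ * ω ^ 2 * (2 * r))) (r : ℂ) := by
    have := (((hasDerivAt_id (r : ℂ)).pow 2).const_mul (3 / 2 * δ * ω ^ 2)).cexp
    refine HasDerivAt.congr_deriv this ?_
    simp
  refine h.comp_ofReal.congr_deriv ?_
  rw [gaussWeight]
  ring

open MeasureTheory in
theorem integrableOn_gaussWeight_mul_pow {δ ω : ℂ} (h : (δ * ω ^ 2).re < 0) (n : ℕ) :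
    IntegrableOn (fun r : ℝ => gaussWeight δ ω r * (ω * r) ^ n) (Set.Ioi 0) := by
  have hi := (integrableOn_pow_mul_exp_quadratic (c := -(3 / 2) * (δ * ω ^ 2).re)
    (by linarith) 0 n).const_mul (‖ω‖ ^ n)
  refine hi.mono' (((continuous_gaussWeight δ ω).mul (by fun_prop)).aestronglyMeasurable) ?_
  filter_upwards [ae_restrict_mem measurableSet_Ioi] with r hr
  rw [norm_mul, norm_gaussWeight, norm_pow, norm_mul, norm_real,
    Real.norm_of_nonneg (le_of_lt hr), mul_pow, zero_mul, add_zero]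
  apply le_of_eq
  ring

theorem tendsto_pow_mul_gaussWeight {δ ω : ℂ} (h : (δ * ω ^ 2).re < 0) (n : ℕ) :
    Tendsto (fun r : ℝ => (r : ℂ) ^ n * gaussWeight δ ω r) atTop (𝓝 0) := by
  set c := -(3 / 2) * (δ * ω ^ 2).re with hc
  have hc0 : 0 < c := by rw [hc]; linarith
  refine squeeze_zero_norm' (a := fun r => (n.factorial : ℝ) * Real.exp (-r)) ?_ ?_
  · filter_upwards [eventually_ge_atTop (0 : ℝ), eventually_ge_atTop (2 / c)] with r h0 h1
    rw [norm_mul, norm_gaussWeight, norm_pow, norm_real, Real.norm_of_nonneg h0, ← hc]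
    have h2 := Real.pow_div_factorial_le_exp r h0 n
    rw [div_le_iff₀' (by positivity)] at h2
    refine (mul_le_mul_of_nonneg_right h2 (Real.exp_pos _).le).trans ?_
    rw [mul_assoc, ← Real.exp_add]
    refine mul_le_mul_of_nonneg_left (Real.exp_le_exp.mpr ?_) (by positivity)
    have h3 : 2 ≤ c * r := by rwa [div_le_iff₀' hc0] at h1
    nlinarith
  · rw [show (0 : ℝ) = (n.factorial : ℝ) * 0 by ring]
    exact (Real.tendsto_exp_neg_atTop_nhds_zero).const_mul _

open MeasureTheory in
theorem gaussRayMoment_add_two {δ ω : ℂ} (hδ : δ ≠ 0) (h : (δ * ω ^ 2).re < 0) (n : ℕ) :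
    gaussRayMoment δ ω (n + 2) = ((n : ℂ) + 1) / (-3 * δ) * gaussRayMoment δ ω n := by
  have hd : ∀ r : ℝ, HasDerivAt (fun r : ℝ => ω ^ (n + 1) * ((r : ℂ) ^ (n + 1) * gaussWeight δ ω r))
      (ω * ((n + 1) * (gaussWeight δ ω r * (ω * r) ^ n) +
        3 * δ * (gaussWeight δ ω r * (ω * r) ^ (n + 2)))) r := by
    intro r
    have h1 : HasDerivAt (fun r : ℝ => (r : ℂ) ^ (n + 1)) (((n + 1 : ℕ) : ℂ) * (r : ℂ) ^ n) r := by
      simpa using (hasDerivAt_pow (n + 1) (r : ℂ)).comp_ofReal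
    refine ((h1.mul (hasDerivAt_gaussWeight δ ω r)).const_mul (ω ^ (n + 1))).congr_deriv ?_
    push_cast
    ring
  have hint := integral_Ioi_of_hasDerivAt_of_tendsto (a := 0)
    (hd 0).continuousAt.continuousWithinAt (fun r _ => hd r)
    ((((integrableOn_gaussWeight_mul_pow h n).const_mul _).add
      ((integrableOn_gaussWeight_mul_pow h (n + 2)).const_mul _)).const_mul _)
    ((tendsto_pow_mul_gaussWeight h (n + 1)).const_mul _)
  rw [integral_const_mul, integral_add ((integrableOn_gaussWeight_mul_pow h n).const_mul _)
    ((integrableOn_gaussWeight_mul_pow h (n + 2)).const_mul _), integral_const_mul,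
    integral_const_mul] at hint
  simp only [ofReal_zero, zero_pow n.succ_ne_zero, zero_mul, mul_zero, sub_zero] at hint
  rw [gaussRayMoment, gaussRayMoment, div_mul_eq_mul_div, eq_div_iff (by simpa using hδ)]
  linear_combination -hint

open MeasureTheory in
theorem gaussRayMoment_one {δ ω : ℂ} (hδ : δ ≠ 0) (h : (δ * ω ^ 2).re < 0) :
    gaussRayMoment δ ω 1 = 1 / (-3 * δ) := by
  have hd : ∀ r : ℝ, HasDerivAt (gaussWeight δ ω)
      (3 * δ * ω * (gaussWeight δ ω r * (ω * r) ^ 1)) r := fun r =>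
    (hasDerivAt_gaussWeight δ ω r).congr_deriv (by ring)
  have hlim : Tendsto (gaussWeight δ ω) atTop (𝓝 0) := by
    simpa using tendsto_pow_mul_gaussWeight h 0
  have hint := integral_Ioi_of_hasDerivAt_of_tendsto (a := 0)
    (hd 0).continuousAt.continuousWithinAt (fun r _ => hd r)
    ((integrableOn_gaussWeight_mul_pow h 1).const_mul _) hlim
  rw [integral_const_mul] at hint
  have h0 : gaussWeight δ ω 0 = 1 := by simp [gaussWeight]
  rw [gaussRayMoment, eq_div_iff (by simpa using hδ)]
  linear_combination -hint + h0

/-- The auxiliary u is the square root of -δω² with positive real part; it fixes the branch in the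
Gaussian integral and reduces the dependence on the ray to the factor ω/u. -/
theorem gaussRayMoment_zero {δ ω u : ℂ} (hu : -δ * ω ^ 2 = u ^ 2) (hu0 : 0 < u.re)
    (h : (δ * ω ^ 2).re < 0) :
    gaussRayMoment δ ω 0 = ω / u * (√(2 * Real.pi / 3) : ℝ) / 2 := by
  have hb : 0 < (3 / 2 * u ^ 2).re := by
    rw [show (3 / 2 : ℂ) * u ^ 2 = ((3 / 2 : ℝ) : ℂ) * u ^ 2 by push_cast; rfl, re_ofReal_mul, ← hu,
      neg_mul, neg_re]
    linarith
  have hi := integral_gaussian_complex_Ioi hb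
  have hune : u ≠ 0 := by rintro rfl; simp at hu0
  have hw : ∀ r : ℝ, gaussWeight δ ω r * (ω * r) ^ 0 = exp (-(3 / 2 * u ^ 2) * (r : ℂ) ^ 2) := by
    intro r
    rw [pow_zero, mul_one, gaussWeight, ← hu]
    congr 1
    ring
  have hs : (Real.pi / (3 / 2 * u ^ 2) : ℂ) = (((√(2 * Real.pi / 3) : ℝ) : ℂ) / u) ^ 2 := by
    rw [div_pow, ← ofReal_pow, Real.sq_sqrt (by positivity)]
    push_cast
    field_simp
  have hre : 0 < (((√(2 * Real.pi / 3) : ℝ) : ℂ) / u).re := by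
    rw [div_eq_mul_inv, re_ofReal_mul, inv_re]
    have := normSq_pos.mpr hune
    positivity
  simp only [gaussRayMoment, hw]
  rw [hi, hs, one_div, sq_cpow_two_inv hre]
  ring

theorem eq_const_mul_gaussMoment {δ e : ℂ} {E : ℕ → ℂ} (h0 : E 0 = e) (h1 : E 1 = 0)
    (h2 : ∀ n, E (n + 2) = ((n : ℂ) + 1) / (-3 * δ) * E n) (n : ℕ) : E n = e * gaussMoment δ n := by
  induction n using Nat.twoStepInduction with
  | zero => rw [h0, gaussMoment, mul_one]
  | one => rw [h1, gaussMoment, mul_zero]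
  | more n ih _ => rw [h2, ih, gaussMoment_add_two]; ring

theorem expMoment_gaussMoment (δ e x : ℂ) (j : ℕ) :
    expMoment (fun n => e * gaussMoment δ n) x j =
      e * ∑ k ∈ Finset.range (j + 1), momentCoeff δ j k * x ^ k := by
  rw [expMoment, Finset.mul_sum]
  refine Finset.sum_congr rfl fun k hk => ?_
  rw [momentCoeff, if_pos (by simp at hk; omega)]
  ring

/-- Odd j contribute nothing because they involve only odd moments; the even index j = 2m yields
Q_m. The series in μ is thus a series in μ². -/
theorem sum_expMoment_gaussMoment (δ e x μ : ℂ) (N : ℕ) :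
    ∑ j ∈ Finset.range (2 * N), μ ^ j * expMoment (fun n => e * gaussMoment δ n) x j =
      e * ∑ m ∈ Finset.range N, (momentPoly δ m).eval x * (μ ^ 2) ^ m := by
  induction N with
  | zero => simp
  | succ N ih =>
    rw [show 2 * (N + 1) = 2 * N + 1 + 1 by ring, Finset.sum_range_succ, Finset.sum_range_succ, ih,
      expMoment_gaussMoment, expMoment_gaussMoment, Finset.sum_range_succ _ N, momentPoly_eval,
      Finset.sum_eq_zero (s := Finset.range (2 * N + 1 + 1)) fun k _ => by
        rw [momentCoeff_odd, zero_mul]]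
    ring

theorem pow_div_factorial_cubic (x v : ℂ) (j : ℕ) :
    (v ^ 3 - 3 * x * v) ^ j / (j.factorial : ℂ) = ∑ k ∈ Finset.range (j + 1),
      (-3) ^ k / ((k.factorial : ℂ) * ((j - k).factorial : ℂ)) * x ^ k * v ^ (3 * j - 2 * k) := by
  rw [show v ^ 3 - 3 * x * v = -3 * x * v + v ^ 3 by ring, add_pow, Finset.sum_div]
  refine Finset.sum_congr rfl fun k hk => ?_
  have hk' : k ≤ j := by simp at hk; omega
  have hj : (j.factorial : ℂ) ≠ 0 := by exact_mod_cast j.factorial_ne_zero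
  have h1 : (k.factorial : ℂ) ≠ 0 := by exact_mod_cast k.factorial_ne_zero
  have h2 : ((j - k).factorial : ℂ) ≠ 0 := by exact_mod_cast (j - k).factorial_ne_zero
  have hc : ((j.choose k : ℕ) : ℂ) * k.factorial * (j - k).factorial = j.factorial := by
    exact_mod_cast Nat.choose_mul_factorial_mul_factorial hk'
  have hv : v ^ (3 * j - 2 * k) = v ^ k * (v ^ 3) ^ (j - k) := by
    rw [← pow_mul, ← pow_add]
    congr 1
    omega
  rw [hv, ← hc, mul_pow, mul_pow]
  have h3 : ((j.choose k : ℕ) : ℂ) ≠ 0 := by exact_mod_cast (Nat.choose_pos hk').ne'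
  field_simp

open MeasureTheory in
theorem integral_gaussWeight_mul_pow_div_factorial {δ ω : ℂ} (h : (δ * ω ^ 2).re < 0) (x μ : ℂ)
    (j : ℕ) :
    IntegrableOn (fun r : ℝ => gaussWeight δ ω r *
      ((μ * ((ω * r) ^ 3 - 3 * x * (ω * r))) ^ j / (j.factorial : ℂ))) (Set.Ioi 0) ∧
    ω * ∫ r in Set.Ioi (0 : ℝ), gaussWeight δ ω r *
      ((μ * ((ω * r) ^ 3 - 3 * x * (ω * r))) ^ j / (j.factorial : ℂ)) =
      μ ^ j * expMoment (gaussRayMoment δ ω) x j := by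
  have e : (fun r : ℝ => gaussWeight δ ω r *
      ((μ * ((ω * r) ^ 3 - 3 * x * (ω * r))) ^ j / (j.factorial : ℂ))) = fun r : ℝ =>
      ∑ k ∈ Finset.range (j + 1),
        μ ^ j * ((-3) ^ k / ((k.factorial : ℂ) * ((j - k).factorial : ℂ)) * x ^ k) *
          (gaussWeight δ ω r * (ω * r) ^ (3 * j - 2 * k)) := by
    funext r
    rw [mul_pow, mul_div_assoc, pow_div_factorial_cubic, Finset.mul_sum, Finset.mul_sum]
    exact Finset.sum_congr rfl fun k _ => by ring
  have hi : ∀ k ∈ Finset.range (j + 1), IntegrableOn (fun r : ℝ =>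
        μ ^ j * ((-3) ^ k / ((k.factorial : ℂ) * ((j - k).factorial : ℂ)) * x ^ k) *
          (gaussWeight δ ω r * (ω * r) ^ (3 * j - 2 * k))) (Set.Ioi 0) := fun k _ =>
    (integrableOn_gaussWeight_mul_pow h _).const_mul _
  rw [e]
  refine ⟨integrable_finsetSum _ hi, ?_⟩
  rw [integral_finsetSum _ hi, expMoment, Finset.mul_sum, Finset.mul_sum]
  refine Finset.sum_congr rfl fun k _ => ?_
  rw [integral_const_mul, gaussRayMoment]
  ring

open MeasureTheory in
/-- The expansion of `gaussRay` in powers of `μ`. -/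
theorem gaussRay_expansion {δ ω : ℂ} (h : (δ * ω ^ 2).re < 0) (x : ℂ) (J : ℕ) :
    ∃ C : ℝ, ∀ μ : ℂ, ‖μ‖ ≤ 1 → (μ * ω ^ 3).re ≤ 0 →
      ‖gaussRay δ ω x μ - ∑ j ∈ Finset.range J, μ ^ j * expMoment (gaussRayMoment δ ω) x j‖ ≤
        C * ‖μ‖ ^ J := by
  set c := -(3 / 2) * (δ * ω ^ 2).re with hc
  have hc0 : 0 < c := by rw [hc]; linarith
  set b := 3 * ‖x‖ * ‖ω‖ with hb
  set K := ‖ω‖ ^ 3 + b with hK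
  have hb0 : 0 ≤ b := by positivity
  have hK0 : 0 ≤ K := by positivity
  -- D collects the constants from |w|^J ≤ |μ|^J K^J (1+r)^{3J} and (1+r)^{3J} ≤ (3J)! e^{1+r}.
  set D := K ^ J * ((3 * J).factorial : ℝ) * Real.exp 1 with hD
  refine ⟨‖ω‖ * ∫ r in Set.Ioi (0 : ℝ), D * Real.exp (-c * r ^ 2 + (b + 1) * r), fun μ hμ hre => ?_⟩
  -- The cubic part has nonpositive real part by the choice of direction, so the exponential grows
  -- at most like e^{br}, uniformly in μ, and the Gaussian weight dominates it.
  have hre' : ∀ r : ℝ, 0 ≤ r → (μ * ((ω * r) ^ 3 - 3 * x * (ω * r))).re ≤ b * r := by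
    intro r hr
    rw [show μ * ((ω * r) ^ 3 - 3 * x * (ω * r)) =
      ((r ^ 3 : ℝ) : ℂ) * (μ * ω ^ 3) + -(μ * (3 * x * (ω * r))) by push_cast; ring, add_re,
      re_ofReal_mul]
    have h1 : r ^ 3 * (μ * ω ^ 3).re ≤ 0 :=
      mul_nonpos_of_nonneg_of_nonpos (by positivity) hre
    have h2 : (-(μ * (3 * x * (ω * r)))).re ≤ b * r := by
      refine (re_le_norm _).trans ?_
      rw [norm_neg, norm_mul, norm_mul, norm_mul, norm_mul, norm_real, Real.norm_of_nonneg hr, hb,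
        show ‖(3 : ℂ)‖ = 3 by norm_num]
      refine (mul_le_of_le_one_left (by positivity) hμ).trans (le_of_eq (by ring))
    linarith
  have hnorm : ∀ r : ℝ, 0 ≤ r →
      ‖μ * ((ω * r) ^ 3 - 3 * x * (ω * r))‖ ≤ ‖μ‖ * (K * (1 + r) ^ 3) := by
    intro r hr
    rw [norm_mul]
    refine mul_le_mul_of_nonneg_left ((norm_sub_le _ _).trans ?_) (norm_nonneg _)
    rw [norm_pow, norm_mul, norm_mul, norm_mul, norm_mul, norm_real, Real.norm_of_nonneg hr,
      show ‖(3 : ℂ)‖ = 3 by norm_num, show 3 * ‖x‖ * (‖ω‖ * r) = b * r by rw [hb]; ring, hK, add_mul,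
      mul_pow]
    have h1 : r ^ 3 ≤ (1 + r) ^ 3 := pow_le_pow_left₀ hr (by linarith) 3
    have h2 : r ≤ (1 + r) ^ 3 := by nlinarith [pow_nonneg hr 2, pow_nonneg hr 3]
    gcongr
  have hterm := integral_gaussWeight_mul_pow_div_factorial h x μ
  have hpoint : ∀ r : ℝ, 0 ≤ r →
      ‖gaussWeight δ ω r * (exp (μ * ((ω * r) ^ 3 - 3 * x * (ω * r))) - ∑ j ∈ Finset.range J,
        (μ * ((ω * r) ^ 3 - 3 * x * (ω * r))) ^ j / (j.factorial : ℂ))‖ ≤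
        ‖μ‖ ^ J * (D * Real.exp (-c * r ^ 2 + (b + 1) * r)) := by
    intro r hr
    rw [norm_mul, norm_gaussWeight, ← hc]
    have h1 := norm_exp_sub_sum_le_max (μ * ((ω * r) ^ 3 - 3 * x * (ω * r))) J
    have h2 : max 1 (Real.exp (μ * ((ω * r) ^ 3 - 3 * x * (ω * r))).re) ≤ Real.exp (b * r) :=
      max_le (Real.one_le_exp (by positivity)) (Real.exp_le_exp.mpr (hre' r hr))
    have h3 := pow_le_pow_left₀ (norm_nonneg _) (hnorm r hr) J
    have h4 := Real.pow_div_factorial_le_exp (1 + r) (by linarith) (3 * J)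
    rw [div_le_iff₀' (by positivity)] at h4
    have h5 : ‖μ * ((ω * r) ^ 3 - 3 * x * (ω * r))‖ ^ J ≤
        ‖μ‖ ^ J * (K ^ J * (((3 * J).factorial : ℝ) * Real.exp (1 + r))) := by
      refine h3.trans ?_
      rw [mul_pow, mul_pow, ← pow_mul]
      gcongr
    calc _ ≤ Real.exp (-c * r ^ 2) * (‖μ‖ ^ J * (K ^ J * (((3 * J).factorial : ℝ) *
          Real.exp (1 + r))) * Real.exp (b * r)) := by
          refine mul_le_mul_of_nonneg_left (h1.trans ?_) (Real.exp_pos _).le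
          exact mul_le_mul h5 h2 (by positivity) (by positivity)
      _ = _ := by
          rw [hD, show -c * r ^ 2 + (b + 1) * r = -c * r ^ 2 + r + b * r by ring, Real.exp_add,
            Real.exp_add, Real.exp_add]
          ring
  have hgi := ((integrableOn_exp_quadratic hc0 (b + 1)).const_mul D)
  have hmeas : AEStronglyMeasurable (fun r : ℝ => gaussWeight δ ω r *
      (exp (μ * ((ω * r) ^ 3 - 3 * x * (ω * r))) - ∑ j ∈ Finset.range J,
        (μ * ((ω * r) ^ 3 - 3 * x * (ω * r))) ^ j / (j.factorial : ℂ)))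
      (volume.restrict (Set.Ioi 0)) :=
    ((continuous_gaussWeight δ ω).mul (by fun_prop)).aestronglyMeasurable
  have hae : ∀ᵐ r : ℝ ∂(volume.restrict (Set.Ioi 0)), ‖gaussWeight δ ω r *
      (exp (μ * ((ω * r) ^ 3 - 3 * x * (ω * r))) - ∑ j ∈ Finset.range J,
        (μ * ((ω * r) ^ 3 - 3 * x * (ω * r))) ^ j / (j.factorial : ℂ))‖ ≤
        ‖μ‖ ^ J * (D * Real.exp (-c * r ^ 2 + (b + 1) * r)) := by
    filter_upwards [ae_restrict_mem measurableSet_Ioi] with r hr using hpoint r (le_of_lt hr)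
  have hremi : IntegrableOn (fun r : ℝ => gaussWeight δ ω r *
      (exp (μ * ((ω * r) ^ 3 - 3 * x * (ω * r))) - ∑ j ∈ Finset.range J,
        (μ * ((ω * r) ^ 3 - 3 * x * (ω * r))) ^ j / (j.factorial : ℂ))) (Set.Ioi 0) :=
    (hgi.const_mul (‖μ‖ ^ J)).mono' hmeas hae
  have hsumi : IntegrableOn (fun r : ℝ => ∑ j ∈ Finset.range J, gaussWeight δ ω r *
      ((μ * ((ω * r) ^ 3 - 3 * x * (ω * r))) ^ j / (j.factorial : ℂ))) (Set.Ioi 0) :=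
    integrable_finsetSum _ fun j _ => (hterm j).1
  have hsplit : gaussRay δ ω x μ -
      ∑ j ∈ Finset.range J, μ ^ j * expMoment (gaussRayMoment δ ω) x j =
      ω * ∫ r in Set.Ioi (0 : ℝ), gaussWeight δ ω r *
      (exp (μ * ((ω * r) ^ 3 - 3 * x * (ω * r))) - ∑ j ∈ Finset.range J,
        (μ * ((ω * r) ^ 3 - 3 * x * (ω * r))) ^ j / (j.factorial : ℂ)) := by
    have e1 : ∑ j ∈ Finset.range J, μ ^ j * expMoment (gaussRayMoment δ ω) x j =
        ω * ∫ r in Set.Ioi (0 : ℝ), ∑ j ∈ Finset.range J, gaussWeight δ ω r *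
      ((μ * ((ω * r) ^ 3 - 3 * x * (ω * r))) ^ j / (j.factorial : ℂ)) := by
      rw [integral_finsetSum _ fun j _ => (hterm j).1, Finset.mul_sum]
      exact Finset.sum_congr rfl fun j _ => (hterm j).2.symm
    rw [e1, gaussRay, sub_eq_iff_eq_add, ← mul_add, ← integral_add hremi hsumi]
    congr 2 with r
    rw [← Finset.mul_sum]
    ring
  rw [hsplit, norm_mul, mul_assoc]
  refine mul_le_mul_of_nonneg_left ?_ (norm_nonneg _)
  refine (norm_integral_le_of_norm_le (hgi.const_mul (‖μ‖ ^ J)) hae).trans (le_of_eq ?_)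
  rw [integral_const_mul, mul_comm]

theorem exp_im_lt_of_abs_im_lt {w : ℂ} (h : |w.im| < Real.pi / 6) :
    √3 * |(exp w).im| < (exp w).re := by
  have hpi := Real.pi_pos
  rw [exp_re, exp_im, abs_mul, abs_of_pos (Real.exp_pos _),
    Real.abs_sin_eq_sin_abs_of_abs_le_pi (by linarith), ← Real.cos_abs w.im]
  have h0 := abs_nonneg w.im
  have h1 : Real.sin |w.im| < 1 / 2 := by
    rw [← Real.sin_pi_div_six]
    exact Real.sin_lt_sin_of_lt_of_le_pi_div_two (by linarith) (by linarith) h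
  have h2 : √3 / 2 < Real.cos |w.im| := by
    rw [← Real.cos_pi_div_six]
    exact Real.cos_lt_cos_of_nonneg_of_le_pi_div_two h0 (by linarith) h
  have h3 : 0 < √3 := by positivity
  have h4 : √3 * Real.sin |w.im| < √3 * (1 / 2) := mul_lt_mul_of_pos_left h1 h3
  have h5 : √3 * Real.sin |w.im| < Real.cos |w.im| := by linarith
  rw [mul_left_comm]
  exact mul_lt_mul_of_pos_left h5 (Real.exp_pos _)

/-! ### Rescaling at the critical point -/

/-- The argument of the Airy functions in terms of `ℓ = log λ` and `x = ζ²`. -/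
noncomputable def airyArgLog (ℓ x : ℂ) : ℂ :=
  exp ((log 3 - ℓ) / 3) ^ 2 * (1 / 4 + exp ℓ * x)

theorem airyArg_eq_airyArgLog {l : ℂ} (hl : l ≠ 0) (harg : |arg l| < Real.pi / 2) (z : ℂ) :
    airyArg l z = airyArgLog (log l) (zetaVar z ^ 2) := by
  have hpi := Real.pi_pos
  have h9 : (9 / l ^ 2 : ℂ) = exp (2 * (log 3 - log l)) := by
    rw [show 2 * (log 3 - log l) = ((2 : ℕ) : ℂ) * (log 3 - log l) by push_cast; rfl, exp_nat_mul,
      exp_sub, exp_log hl, exp_log (by norm_num), div_pow]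
    norm_num
  have h3 : (log 3).im = 0 := by
    rw [log_im, show (3 : ℂ) = ((3 : ℝ) : ℂ) by norm_num, arg_ofReal_of_nonneg (by norm_num)]
  have him : (2 * (log 3 - log l)).im = -2 * arg l := by
    rw [show (2 : ℂ) = ((2 : ℝ) : ℂ) by norm_num, im_ofReal_mul, sub_im, h3, log_im]
    ring
  have habs := abs_lt.mp harg
  -- As |2 arg λ| < π, the logarithm of 9/λ² is 2(log 3 - log λ), so the principal cube root is the
  -- expected exponential.
  rw [airyArg, airyArgLog, h9, cpow_def_of_ne_zero (exp_ne_zero _), log_exp (by rw [him]; linarith)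
    (by rw [him]; linarith), exp_log hl, ← exp_nat_mul]
  congr 2
  push_cast
  ring

/-- The point δK/2 is critical for s³/3 - K²s/4, so the terms of order 1/μ in v cancel; K³μ² = 3
normalizes the others. -/
theorem airyKernel_shift {δ : ℂ} (hδ : δ ^ 2 = 1) (ℓ x v : ℂ) :
    airyKernel (airyArgLog ℓ x)
        (δ * exp ((log 3 - ℓ) / 3) / 2 + exp ((log 3 - ℓ) / 3) * exp (ℓ / 2) * v) =
      exp (-(δ / (4 * exp ℓ)) - 3 / 2 * δ * x) *
        (exp (3 / 2 * δ * v ^ 2) * exp (exp (ℓ / 2) * (v ^ 3 - 3 * x * v))) := by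
  have hK : exp ((log 3 - ℓ) / 3) ^ 3 * exp (ℓ / 2) ^ 2 = 3 := by
    rw [← exp_nat_mul, ← exp_nat_mul, ← exp_add]
    push_cast
    rw [show 3 * ((log 3 - ℓ) / 3) + 2 * (ℓ / 2) = log 3 by ring, exp_log (by norm_num)]
  have hl : exp ℓ = exp (ℓ / 2) ^ 2 := by
    rw [← exp_nat_mul]
    congr 1
    push_cast
    ring
  rw [airyKernel, airyArgLog, hl]
  have hμ : exp (ℓ / 2) ≠ 0 := exp_ne_zero _
  have hK' : exp ((log 3 - ℓ) / 3) ^ 3 = 3 / exp (ℓ / 2) ^ 2 := by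
    rw [eq_div_iff (pow_ne_zero 2 hμ), hK]
  generalize exp ((log 3 - ℓ) / 3) = K at *
  generalize exp (ℓ / 2) = μ at *
  rw [← exp_add, ← exp_add]
  congr 1
  have e : 1 / 3 * (δ * K / 2 + K * μ * v) ^ 3 -
      K ^ 2 * (1 / 4 + μ ^ 2 * x) * (δ * K / 2 + K * μ * v) =
      K ^ 3 * (1 / 3 * (δ / 2 + μ * v) ^ 3 - (1 / 4 + μ ^ 2 * x) * (δ / 2 + μ * v)) := by ring
  rw [e, hK']
  field_simp
  linear_combination (4 * δ + 24 * μ * v) * hδ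

open MeasureTheory in
/-- An Airy contour integral, shifted to the critical point and rescaled. -/
theorem airyRay_eq_gaussRay {δ : ℂ} (hδ : δ ^ 2 = 1) {ℓ x : ℂ} {F : ℂ → ℂ}
    (hF : ∀ s, HasDerivAt F (airyKernel (airyArgLog ℓ x) s) s) {φ₀ φ : ℝ}
    (hφ₀ : exp (φ₀ * I) ^ 3 = -1) (hφ : |ℓ.im / 6 + φ - φ₀| < Real.pi / 6) :
    airyRay (exp (φ₀ * I)) (airyArgLog ℓ x) =
      (F (δ * exp ((log 3 - ℓ) / 3) / 2) - F 0) +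
        exp (log 3 / 3 + ℓ / 6) * exp (-(δ / (4 * exp ℓ)) - 3 / 2 * δ * x) *
          gaussRay δ (exp (φ * I)) x (exp (ℓ / 2)) := by
  set K := exp ((log 3 - ℓ) / 3) with hK
  -- ρ is the ratio of the direction Kμe^{iφ} of the rescaled ray to the original e^{iφ₀}; its
  -- argument is Im ℓ/6 + φ - φ₀.
  set ρ := exp (log 3 / 3 + ℓ / 6 + (φ - φ₀ : ℝ) * I) with hρ
  have h3 : (log 3 / 3).im = 0 := by
    rw [show (log 3 / 3 : ℂ) = ((Real.log 3 / 3 : ℝ) : ℂ) by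
      rw [ofReal_div, ofReal_log (by norm_num)]; norm_num, ofReal_im]
  have h6 : (ℓ / 6).im = ℓ.im / 6 := by
    rw [show (6 : ℂ) = ((6 : ℝ) : ℂ) by norm_num, div_ofReal_im]
  have him : (log 3 / 3 + ℓ / 6 + (φ - φ₀ : ℝ) * I).im = ℓ.im / 6 + φ - φ₀ := by
    rw [add_im, add_im, h3, h6, im_ofReal_mul, I_im]
    ring
  have hsec : √3 * |ρ.im| < ρ.re := exp_im_lt_of_abs_im_lt (by rw [him]; exact hφ)
  have hKμ : exp (log 3 / 3 + ℓ / 6) = K * exp (ℓ / 2) := by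
    rw [hK, ← exp_add]
    congr 1
    ring
  have hdir : exp (φ₀ * I) * ρ = K * exp (ℓ / 2) * exp (φ * I) := by
    rw [← hKμ, hρ, ← exp_add, ← exp_add]
    congr 1
    push_cast
    ring
  rw [airyRay_eq_shift hF hφ₀ hsec (δ * K / 2), hdir, hKμ, gaussRay]
  have hint : ∀ r : ℝ, airyKernel (airyArgLog ℓ x)
      (δ * K / 2 + K * exp (ℓ / 2) * exp (φ * I) * r) =
      exp (-(δ / (4 * exp ℓ)) - 3 / 2 * δ * x) * (gaussWeight δ (exp (φ * I)) r *
        exp (exp (ℓ / 2) * ((exp (φ * I) * r) ^ 3 - 3 * x * (exp (φ * I) * r)))) := by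
    intro r
    rw [mul_assoc (K * exp (ℓ / 2)), airyKernel_shift hδ, gaussWeight, mul_pow (exp (φ * I)) _ 2,
      mul_assoc (3 / 2 * δ)]
  simp only [hint]
  rw [integral_const_mul]
  ring

/-! ### Combining the rays -/

theorem expMoment_sub (E E' : ℕ → ℂ) (x : ℂ) (j : ℕ) :
    expMoment E x j - expMoment E' x j = expMoment (fun n => E n - E' n) x j := by
  simp only [expMoment]
  rw [← Finset.sum_sub_distrib]
  exact Finset.sum_congr rfl fun k _ => by ring

theorem expMoment_add (E E' : ℕ → ℂ) (x : ℂ) (j : ℕ) :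
    expMoment E x j + expMoment E' x j = expMoment (fun n => E n + E' n) x j := by
  simp only [expMoment]
  rw [← Finset.sum_add_distrib]
  exact Finset.sum_congr rfl fun k _ => by ring

theorem expMoment_const_mul (c : ℂ) (E : ℕ → ℂ) (x : ℂ) (j : ℕ) :
    c * expMoment E x j = expMoment (fun n => c * E n) x j := by
  simp only [expMoment]
  rw [Finset.mul_sum]
  exact Finset.sum_congr rfl fun k _ => by ring

theorem re_mul_exp_sq (φ : ℝ) : (exp (φ * I) ^ 2).re = Real.cos (2 * φ) := by
  rw [← exp_nat_mul, show ((2 : ℕ) : ℂ) * (φ * I) = ((2 * φ : ℝ) : ℂ) * I by push_cast; ring,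
    exp_ofReal_mul_I_re]

theorem exp_half_sq (ℓ : ℂ) : exp (ℓ / 2) ^ 2 = exp ℓ := by
  rw [← exp_nat_mul]
  congr 1
  push_cast
  ring

theorem re_exp_half_mul_cube (ℓ : ℂ) (φ : ℝ) : (exp (ℓ / 2) * exp (φ * I) ^ 3).re =
    Real.exp (ℓ.re / 2) * Real.cos (ℓ.im / 2 + 3 * φ) := by
  rw [← exp_nat_mul, ← exp_add, exp_re]
  have h2 : ∀ w : ℂ, w / 2 = w / ((2 : ℝ) : ℂ) := fun w => by norm_num
  have e1 : (ℓ / 2 + ((3 : ℕ) : ℂ) * (φ * I)).re = ℓ.re / 2 := by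
    rw [add_re, h2, div_ofReal_re]
    simp
  have e2 : (ℓ / 2 + ((3 : ℕ) : ℂ) * (φ * I)).im = ℓ.im / 2 + 3 * φ := by
    rw [add_im, h2, div_ofReal_im]
    simp
  rw [e1, e2]

/-- The expansion of the two-ray integral that represents the first generating function. -/
theorem gaussRay_sub_expansion (x : ℂ) (N : ℕ) : ∃ C : ℝ, ∀ ℓ : ℂ, ‖exp ℓ‖ ≤ 1 →
    |ℓ.im| ≤ Real.pi / 2 →
    ‖(gaussRay 1 (exp ((Real.pi / 3 : ℝ) * I)) x (exp (ℓ / 2))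
      - gaussRay 1 (exp ((-(Real.pi / 3) : ℝ) * I)) x (exp (ℓ / 2)))
      - I * (√(2 * Real.pi / 3) : ℝ) *
        ∑ m ∈ Finset.range N, (momentPoly 1 m).eval x * exp ℓ ^ m‖ ≤ C * ‖exp ℓ‖ ^ N := by
  have hpi := Real.pi_pos
  have hcos : Real.cos (2 * (Real.pi / 3)) < 0 :=
    Real.cos_neg_of_pi_div_two_lt_of_lt (by linarith) (by linarith)
  have hp : (1 * exp ((Real.pi / 3 : ℝ) * I) ^ 2).re < 0 := by rwa [one_mul, re_mul_exp_sq]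
  have hm : (1 * exp ((-(Real.pi / 3) : ℝ) * I) ^ 2).re < 0 := by
    rwa [one_mul, re_mul_exp_sq, mul_neg, Real.cos_neg]
  have hsin : 0 < Real.sin (Real.pi / 3) := Real.sin_pos_of_pos_of_lt_pi (by linarith) (by linarith)
  obtain ⟨C₁, h₁⟩ := gaussRay_expansion hp x (2 * N)
  obtain ⟨C₂, h₂⟩ := gaussRay_expansion hm x (2 * N)
  have hE : (fun n => gaussRayMoment 1 (exp ((Real.pi / 3 : ℝ) * I)) n -
      gaussRayMoment 1 (exp ((-(Real.pi / 3) : ℝ) * I)) n) =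
      fun n => I * (√(2 * Real.pi / 3) : ℝ) * gaussMoment 1 n := by
    funext n
    refine eq_const_mul_gaussMoment (E := fun n => gaussRayMoment 1 (exp ((Real.pi / 3 : ℝ) * I)) n -
      gaussRayMoment 1 (exp ((-(Real.pi / 3) : ℝ) * I)) n) ?_ ?_ (fun n => ?_) n
    -- Here u = ∓iω has real part sin(π/3) > 0, so ω/u = ±i and the difference of the two
    -- half-Gaussians is i√(2π/3).
    · rw [gaussRayMoment_zero (u := -I * exp ((Real.pi / 3 : ℝ) * I)) ?_ ?_ hp,
        gaussRayMoment_zero (u := I * exp ((-(Real.pi / 3) : ℝ) * I)) ?_ ?_ hm]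
      · have e1 := exp_ne_zero ((Real.pi / 3 : ℝ) * I)
        have e2 := exp_ne_zero ((-(Real.pi / 3) : ℝ) * I)
        have hI := I_ne_zero
        field_simp
        linear_combination -2 * I_sq
      · rw [mul_pow, I_sq]
      · rw [I_mul_re, exp_ofReal_mul_I_im, Real.sin_neg, neg_neg]
        exact hsin
      · rw [mul_pow, neg_sq, I_sq]
      · rw [neg_mul, neg_re, I_mul_re, exp_ofReal_mul_I_im, neg_neg]
        exact hsin
    · rw [gaussRayMoment_one one_ne_zero hp, gaussRayMoment_one one_ne_zero hm, sub_self]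
    · rw [gaussRayMoment_add_two one_ne_zero hp, gaussRayMoment_add_two one_ne_zero hm]
      ring
  refine ⟨C₁ + C₂, fun ℓ hℓ harg => ?_⟩
  have hμ : ‖exp (ℓ / 2)‖ ^ 2 = ‖exp ℓ‖ := by rw [← norm_pow, exp_half_sq]
  have hμ1 : ‖exp (ℓ / 2)‖ ≤ 1 := by
    rw [← hμ] at hℓ
    exact (sq_le_one_iff₀ (norm_nonneg _)).mp hℓ
  have habs := abs_le.mp harg
  have hre : 0 ≤ (exp (ℓ / 2)).re := by
    have h := re_exp_half_mul_cube ℓ 0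
    simp only [ofReal_zero, zero_mul, exp_zero, one_pow, mul_one, mul_zero, add_zero] at h
    rw [h]
    exact mul_nonneg (Real.exp_pos _).le (Real.cos_nonneg_of_mem_Icc ⟨by linarith, by linarith⟩)
  -- Since ω³ = -1, the condition on the cubic term is just Re μ ≥ 0.
  have b₁ := h₁ (exp (ℓ / 2)) hμ1 (by rw [exp_pi_div_three_cube]; simpa using hre)
  have b₂ := h₂ (exp (ℓ / 2)) hμ1 (by rw [exp_neg_pi_div_three_cube]; simpa using hre)
  have hsum := sum_expMoment_gaussMoment 1 (I * (√(2 * Real.pi / 3) : ℝ)) x (exp (ℓ / 2)) N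
  rw [← hE, exp_half_sq] at hsum
  rw [← hsum]
  simp only [← expMoment_sub, mul_sub, Finset.sum_sub_distrib]
  rw [sub_sub_sub_comm, ← hμ, ← pow_mul, add_mul]
  exact (norm_sub_le _ _).trans (add_le_add b₁ b₂)

/-- The expansion of the three-ray integral that represents the second generating function. -/
theorem gaussRay_add_expansion {η : ℝ} (hη : 0 < η) (hη1 : η ≤ 1) (x : ℂ) (N : ℕ) :
    ∃ C : ℝ, ∀ ℓ : ℂ, ‖exp ℓ‖ ≤ 1 → |ℓ.im| ≤ Real.pi / 2 - η →
    ‖(gaussRay (-1) (exp ((Real.pi / 4 - η / 12 : ℝ) * I)) x (exp (ℓ / 2))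
      + gaussRay (-1) (exp ((-(Real.pi / 4 - η / 12) : ℝ) * I)) x (exp (ℓ / 2))
      - 2 * gaussRay (-1) (exp ((Real.pi : ℝ) * I)) x (exp (ℓ / 2)))
      - 2 * (√(2 * Real.pi / 3) : ℝ) *
        ∑ m ∈ Finset.range N, (momentPoly (-1) m).eval x * exp ℓ ^ m‖ ≤ C * ‖exp ℓ‖ ^ N := by
  have hpi := Real.pi_gt_three
  -- The angle must be below π/4 for the Gaussian to decay, while cos(arg λ/2 + 3φ) ≤ 0 is needed
  -- down to arg λ = -(π/2 - η). Both hold for π/4 - η/12, and so does the rotation bound |arg λ/6 +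
  -- φ - π/3| < π/6; on the full half-plane no single angle would do.
  set φ := Real.pi / 4 - η / 12 with hφ
  have hcos : 0 < Real.cos (2 * φ) := Real.cos_pos_of_mem_Ioo ⟨by linarith, by linarith⟩
  have hp : (-1 * exp (φ * I) ^ 2).re < 0 := by
    rw [neg_one_mul, neg_re, re_mul_exp_sq]
    linarith
  have hm : (-1 * exp ((-φ : ℝ) * I) ^ 2).re < 0 := by
    rw [neg_one_mul, neg_re, re_mul_exp_sq, mul_neg, Real.cos_neg]
    linarith
  have h0 : (-1 * exp ((Real.pi : ℝ) * I) ^ 2).re < 0 := by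
    rw [exp_pi_mul_I]
    norm_num
  have hcos' : 0 < Real.cos φ := Real.cos_pos_of_mem_Ioo ⟨by linarith, by linarith⟩
  obtain ⟨C₁, h₁⟩ := gaussRay_expansion hp x (2 * N)
  obtain ⟨C₂, h₂⟩ := gaussRay_expansion hm x (2 * N)
  obtain ⟨C₃, h₃⟩ := gaussRay_expansion h0 x (2 * N)
  have hδ : (-1 : ℂ) ≠ 0 := by norm_num
  have hE : (fun n => gaussRayMoment (-1) (exp (φ * I)) n +
      gaussRayMoment (-1) (exp ((-φ : ℝ) * I)) n -
      2 * gaussRayMoment (-1) (exp ((Real.pi : ℝ) * I)) n) =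
      fun n => 2 * (√(2 * Real.pi / 3) : ℝ) * gaussMoment (-1) n := by
    funext n
    refine eq_const_mul_gaussMoment (E := fun n => gaussRayMoment (-1) (exp (φ * I)) n +
      gaussRayMoment (-1) (exp ((-φ : ℝ) * I)) n -
      2 * gaussRayMoment (-1) (exp ((Real.pi : ℝ) * I)) n) ?_ ?_ (fun n => ?_) n
    -- The ratios ω/u are 1, 1 and -1, so the total is (1 + 1 + 2)/2 = 2 times √(2π/3).
    · rw [gaussRayMoment_zero (u := exp (φ * I)) (by ring) (by rwa [exp_ofReal_mul_I_re]) hp,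
        gaussRayMoment_zero (u := exp ((-φ : ℝ) * I)) (by ring)
          (by rwa [exp_ofReal_mul_I_re, Real.cos_neg]) hm,
        gaussRayMoment_zero (u := 1) (by rw [exp_pi_mul_I]; norm_num) (by norm_num) h0,
        div_self (exp_ne_zero _), div_self (exp_ne_zero _), exp_pi_mul_I]
      ring
    · rw [gaussRayMoment_one hδ hp, gaussRayMoment_one hδ hm, gaussRayMoment_one hδ h0]
      ring
    · rw [gaussRayMoment_add_two hδ hp, gaussRayMoment_add_two hδ hm, gaussRayMoment_add_two hδ h0]
      ring
  refine ⟨C₁ + C₂ + 2 * C₃, fun ℓ hℓ harg => ?_⟩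
  have hμ : ‖exp (ℓ / 2)‖ ^ 2 = ‖exp ℓ‖ := by rw [← norm_pow, exp_half_sq]
  have hμ1 : ‖exp (ℓ / 2)‖ ≤ 1 := by
    rw [← hμ] at hℓ
    exact (sq_le_one_iff₀ (norm_nonneg _)).mp hℓ
  have habs := abs_le.mp harg
  have b₁ := h₁ (exp (ℓ / 2)) hμ1 (by
    rw [re_exp_half_mul_cube]
    exact mul_nonpos_of_nonneg_of_nonpos (Real.exp_pos _).le
      (Real.cos_nonpos_of_pi_div_two_le_of_le (by linarith) (by linarith)))
  have b₂ := h₂ (exp (ℓ / 2)) hμ1 (by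
    rw [re_exp_half_mul_cube, ← Real.cos_neg]
    exact mul_nonpos_of_nonneg_of_nonpos (Real.exp_pos _).le
      (Real.cos_nonpos_of_pi_div_two_le_of_le (by linarith) (by linarith)))
  have b₃ := h₃ (exp (ℓ / 2)) hμ1 (by
    rw [re_exp_half_mul_cube, ← Real.cos_sub_two_pi]
    exact mul_nonpos_of_nonneg_of_nonpos (Real.exp_pos _).le
      (Real.cos_nonpos_of_pi_div_two_le_of_le (by linarith) (by linarith)))
  have hsum := sum_expMoment_gaussMoment (-1) (2 * (√(2 * Real.pi / 3) : ℝ)) x (exp (ℓ / 2)) N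
  rw [← hE, exp_half_sq] at hsum
  rw [← hsum]
  have hsplit : ∀ j, expMoment (fun n => gaussRayMoment (-1) (exp (φ * I)) n +
      gaussRayMoment (-1) (exp ((-φ : ℝ) * I)) n -
      2 * gaussRayMoment (-1) (exp ((Real.pi : ℝ) * I)) n) x j =
      expMoment (gaussRayMoment (-1) (exp (φ * I))) x j +
      expMoment (gaussRayMoment (-1) (exp ((-φ : ℝ) * I))) x j -
      2 * expMoment (gaussRayMoment (-1) (exp ((Real.pi : ℝ) * I))) x j := fun j => by
    rw [expMoment_const_mul, expMoment_add, expMoment_sub]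
  simp only [hsplit, mul_sub, mul_add, Finset.sum_sub_distrib, Finset.sum_add_distrib]
  simp only [mul_left_comm _ (2 : ℂ), ← Finset.mul_sum]
  rw [← hμ, ← pow_mul, add_mul, add_mul]
  calc _ = ‖(gaussRay (-1) (exp (φ * I)) x (exp (ℓ / 2)) - ∑ j ∈ Finset.range (2 * N),
          exp (ℓ / 2) ^ j * expMoment (gaussRayMoment (-1) (exp (φ * I))) x j) +
        (gaussRay (-1) (exp ((-φ : ℝ) * I)) x (exp (ℓ / 2)) - ∑ j ∈ Finset.range (2 * N),
          exp (ℓ / 2) ^ j * expMoment (gaussRayMoment (-1) (exp ((-φ : ℝ) * I))) x j) -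
        2 * (gaussRay (-1) (exp ((Real.pi : ℝ) * I)) x (exp (ℓ / 2)) - ∑ j ∈ Finset.range (2 * N),
          exp (ℓ / 2) ^ j * expMoment (gaussRayMoment (-1) (exp ((Real.pi : ℝ) * I))) x j)‖ := by
        congr 1
        ring
    _ ≤ _ := by
        refine (norm_sub_le _ _).trans (add_le_add ((norm_add_le _ _).trans (add_le_add b₁ b₂)) ?_)
        rw [norm_mul, show ‖(2 : ℂ)‖ = 2 by norm_num, mul_assoc]
        exact mul_le_mul_of_nonneg_left b₃ (by norm_num)

/-! ### Normalizing constants and the generating functions -/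

theorem ofReal_mul_cpow {r : ℝ} (hr : 0 < r) {w : ℂ} (hw : w ≠ 0) (c : ℂ) :
    ((r : ℂ) * w) ^ c = (r : ℂ) ^ c * w ^ c := by
  have hr' : (r : ℂ) ≠ 0 := ofReal_ne_zero.mpr hr.ne'
  rw [cpow_def_of_ne_zero (mul_ne_zero hr' hw), cpow_def_of_ne_zero hr', cpow_def_of_ne_zero hw,
    log_ofReal_mul hr hw, ofReal_log hr.le, add_mul, exp_add]

theorem ofReal_cpow_half {r : ℝ} (hr : 0 ≤ r) : (r : ℂ) ^ (1 / 2 : ℂ) = ((√r : ℝ) : ℂ) := by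
  rw [Real.sqrt_eq_rpow, ofReal_cpow hr]
  push_cast
  rfl

theorem three_cpow_mul_exp :
    (3 : ℂ) ^ (5 / 12 : ℂ) * exp (log 3 / 3) = (3 : ℂ) ^ (1 / 4 : ℂ) * ((√3 : ℝ) : ℂ) := by
  have h3 : (3 : ℂ) ≠ 0 := by norm_num
  have h : exp (log 3 / 3) = (3 : ℂ) ^ (1 / 3 : ℂ) := by
    rw [cpow_def_of_ne_zero h3]
    congr 1
    ring
  rw [h, ← ofReal_cpow_half (by norm_num), ← cpow_add _ _ h3]
  push_cast
  rw [← cpow_add _ _ h3]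
  norm_num

theorem cpow_neg_sixth_mul_exp {l : ℂ} (hl : l ≠ 0) :
    l ^ (-(1 / 6) : ℂ) * exp (log 3 / 3 + log l / 6) = exp (log 3 / 3) := by
  rw [cpow_def_of_ne_zero hl, ← exp_add]
  congr 1
  ring

theorem sqrt_three_mul_sqrt_two_pi :
    ((√3 : ℝ) : ℂ) * ((√(2 * Real.pi / 3) : ℝ) : ℂ) = ((√(2 * Real.pi) : ℝ) : ℂ) := by
  rw [← ofReal_mul, ← Real.sqrt_mul (by norm_num)]
  congr 2
  ring

/-- The first generating function as a Gaussian contour integral. -/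
theorem genPos_eq_gaussRay {l z : ℂ} (hl : l ≠ 0) (harg : |arg l| < Real.pi / 2)
    (hz : z ∈ slitPlane) :
    genPos l z = zetaVar z ^ (1 / 2 : ℂ) *
      ((3 : ℂ) ^ (1 / 4 : ℂ) * exp (-(3 / 2) * zetaVar z ^ 2)) *
      ((√3 : ℝ) * (√(2 * Real.pi) : ℝ) / (2 * Real.pi * I)) *
      (gaussRay 1 (exp ((Real.pi / 3 : ℝ) * I)) (zetaVar z ^ 2) (exp (log l / 2))
        - gaussRay 1 (exp ((-(Real.pi / 3) : ℝ) * I)) (zetaVar z ^ 2) (exp (log l / 2))) := by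
  obtain ⟨F, hF⟩ := exists_primitive_airyKernel (airyArgLog (log l) (zetaVar z ^ 2))
  have hl6 : |(log l).im / 6| < Real.pi / 6 := by
    rw [log_im, abs_div, abs_of_pos (show (0 : ℝ) < 6 by norm_num)]
    linarith [Real.pi_pos]
  have h1 := airyRay_eq_gaussRay (one_pow 2) hF exp_pi_div_three_cube (φ := Real.pi / 3)
    (by rwa [add_sub_cancel_right])
  have h2 := airyRay_eq_gaussRay (one_pow 2) hF exp_neg_pi_div_three_cube (φ := -(Real.pi / 3))
    (by rwa [add_sub_cancel_right])
  have hsq : (2 * (Real.pi : ℂ) * zetaVar z) ^ (1 / 2 : ℂ) =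
      ((√(2 * Real.pi) : ℝ) : ℂ) * zetaVar z ^ (1 / 2 : ℂ) := by
    rw [← ofReal_cpow_half (by positivity), ← ofReal_mul_cpow (by positivity) (zetaVar_ne_zero hz)]
    push_cast
    rfl
  have hexp : exp (1 / (4 * l)) * exp (-(1 / (4 * l)) - 3 / 2 * 1 * zetaVar z ^ 2) =
      exp (-(3 / 2) * zetaVar z ^ 2) := by
    rw [← exp_add]
    congr 1
    ring
  rw [genPos, airyArg_eq_airyArgLog hl harg, airyAi_eq_airyRay, h1, h2, exp_log hl, hsq]
  generalize gaussRay 1 (exp ((Real.pi / 3 : ℝ) * I)) (zetaVar z ^ 2) (exp (log l / 2)) = G₁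
  generalize gaussRay 1 (exp ((-(Real.pi / 3) : ℝ) * I)) (zetaVar z ^ 2) (exp (log l / 2)) = G₂
  -- The primitive terms F(K/2) - F(0) are common to both rays and cancel in the difference.
  calc _ = ((3 : ℂ) ^ (5 / 12 : ℂ) * (l ^ (-(1 / 6) : ℂ) * exp (log 3 / 3 + log l / 6))) *
        (exp (1 / (4 * l)) * exp (-(1 / (4 * l)) - 3 / 2 * 1 * zetaVar z ^ 2)) *
        zetaVar z ^ (1 / 2 : ℂ) * ((√(2 * Real.pi) : ℝ) / (2 * Real.pi * I)) * (G₁ - G₂) := by ring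
    _ = _ := by
        rw [cpow_neg_sixth_mul_exp hl, three_cpow_mul_exp, hexp]
        ring

/-- The second generating function as a Gaussian contour integral. -/
theorem genNeg_eq_gaussRay {l z : ℂ} {η : ℝ} (hη : 0 < η) (hl : l ≠ 0)
    (harg : |arg l| ≤ Real.pi / 2 - η) (hz : z ∈ slitPlane) :
    genNeg l z = zetaVar z ^ (1 / 2 : ℂ) *
      ((3 : ℂ) ^ (1 / 4 : ℂ) * exp (3 / 2 * zetaVar z ^ 2)) *
      ((√3 : ℝ) * (√(Real.pi / 2) : ℝ) / (2 * Real.pi)) *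
      (gaussRay (-1) (exp ((Real.pi / 4 - η / 12 : ℝ) * I)) (zetaVar z ^ 2) (exp (log l / 2))
      + gaussRay (-1) (exp ((-(Real.pi / 4 - η / 12) : ℝ) * I)) (zetaVar z ^ 2) (exp (log l / 2))
      - 2 * gaussRay (-1) (exp ((Real.pi : ℝ) * I)) (zetaVar z ^ 2) (exp (log l / 2))) := by
  have hpi := Real.pi_pos
  obtain ⟨F, hF⟩ := exists_primitive_airyKernel (airyArgLog (log l) (zetaVar z ^ 2))
  have hδ : (-1 : ℂ) ^ 2 = 1 := by norm_num
  have habs := abs_le.mp harg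
  have h1 := airyRay_eq_gaussRay hδ hF exp_pi_div_three_cube (φ := Real.pi / 4 - η / 12)
    (by rw [log_im, abs_lt]; constructor <;> linarith)
  have h2 := airyRay_eq_gaussRay hδ hF exp_neg_pi_div_three_cube (φ := -(Real.pi / 4 - η / 12))
    (by rw [log_im, abs_lt]; constructor <;> linarith)
  have h3 := airyRay_eq_gaussRay hδ hF (φ₀ := Real.pi) (φ := Real.pi)
    (by rw [exp_pi_mul_I]; norm_num) (by rw [log_im, abs_lt]; constructor <;> linarith)
  have hsq : ((Real.pi : ℂ) * zetaVar z / 2) ^ (1 / 2 : ℂ) =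
      ((√(Real.pi / 2) : ℝ) : ℂ) * zetaVar z ^ (1 / 2 : ℂ) := by
    rw [← ofReal_cpow_half (by positivity), ← ofReal_mul_cpow (by positivity) (zetaVar_ne_zero hz)]
    congr 1
    push_cast
    ring
  have hexp : exp (-(1 / (4 * l))) * exp (-(-1 / (4 * l)) - 3 / 2 * (-1) * zetaVar z ^ 2) =
      exp (3 / 2 * zetaVar z ^ 2) := by
    rw [← exp_add]
    congr 1
    ring
  rw [genNeg, airyArg_eq_airyArgLog hl (by linarith), airyBi_eq_airyRay, h1, h2,
    ← exp_pi_mul_I, h3, exp_log hl, hsq, exp_pi_mul_I]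
  generalize gaussRay (-1) (exp ((Real.pi / 4 - η / 12 : ℝ) * I)) (zetaVar z ^ 2)
    (exp (log l / 2)) = G₁
  generalize gaussRay (-1) (exp ((-(Real.pi / 4 - η / 12) : ℝ) * I)) (zetaVar z ^ 2)
    (exp (log l / 2)) = G₂
  generalize gaussRay (-1) (-1) (zetaVar z ^ 2) (exp (log l / 2)) = G₃
  -- The primitive terms F(-K/2) - F(0) enter with coefficients 1, 1 and -2 and cancel.
  calc _ = ((3 : ℂ) ^ (5 / 12 : ℂ) * (l ^ (-(1 / 6) : ℂ) * exp (log 3 / 3 + log l / 6))) *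
        (exp (-(1 / (4 * l))) * exp (-(-1 / (4 * l)) - 3 / 2 * (-1) * zetaVar z ^ 2)) *
        zetaVar z ^ (1 / 2 : ℂ) * ((√(Real.pi / 2) : ℝ) / (2 * Real.pi)) * (G₁ + G₂ - 2 * G₃) := by
        ring
    _ = _ := by
        rw [cpow_neg_sixth_mul_exp hl, three_cpow_mul_exp, hexp]
        ring

theorem hasGeneratingExpansion_of_bound {F : ℂ → ℂ} {u : ℕ → ℂ}
    (h : ∀ η : ℝ, 0 < η → η ≤ 1 → ∀ N : ℕ, ∃ C : ℝ, ∀ l ∈ sectorSet η, ‖l‖ ≤ 1 →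
      ‖F l - ∑ m ∈ Finset.range N, u (m + 1) * l ^ m‖ ≤ C * ‖l‖ ^ N) :
    HasGeneratingExpansion F u := by
  intro η hη N
  -- Decreasing η enlarges the sector, so η ≤ 1 may be assumed.
  obtain ⟨C, hC⟩ := h (min η 1) (lt_min hη one_pos) (min_le_right _ _) N
  refine IsBigO.of_bound C ?_
  have hball : ∀ᶠ l : ℂ in 𝓝[sectorSet η] 0, ‖l‖ ≤ 1 := by
    refine nhdsWithin_le_nhds ?_
    filter_upwards [Metric.closedBall_mem_nhds (0 : ℂ) one_pos] with l hl
    simpa using hl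
  filter_upwards [hball, self_mem_nhdsWithin] with l h1 h2
  have hsum : ∑ n ∈ Finset.Icc 1 N, u n * l ^ (n - 1) =
      ∑ m ∈ Finset.range N, u (m + 1) * l ^ m := by
    clear hC
    induction N with
    | zero => simp
    | succ N ih =>
      rw [Finset.sum_Icc_succ_top (by omega), ih, Finset.sum_range_succ, Nat.add_sub_cancel]
  rw [hsum, norm_pow]
  exact hC l ⟨h2.1, h2.2.trans (by linarith [min_le_left η 1])⟩ h1

theorem genPos_hasGeneratingExpansion {z : ℂ} (hz : z ∈ slitPlane) {u : ℕ → ℂ}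
    (hu : ∀ m, u (m + 1) = genEig 1 m z) :
    HasGeneratingExpansion (fun l => genPos l z) u := by
  refine hasGeneratingExpansion_of_bound fun η hη _ N => ?_
  obtain ⟨C, hC⟩ := gaussRay_sub_expansion (zetaVar z ^ 2) N
  set A := zetaVar z ^ (1 / 2 : ℂ) * ((3 : ℂ) ^ (1 / 4 : ℂ) * exp (-(3 / 2) * zetaVar z ^ 2)) with hA
  set B : ℂ := (√3 : ℝ) * (√(2 * Real.pi) : ℝ) / (2 * Real.pi * I) with hB
  refine ⟨‖A * B‖ * C, fun l hl hl1 => ?_⟩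
  have hharg : |arg l| ≤ Real.pi / 2 - η := hl.2
  have hbound := hC (log l) (by rwa [exp_log hl.1]) (by rw [log_im]; linarith)
  -- The numerical prefactor is the inverse of the zeroth moment of the combined contour, so the
  -- expansion starts with ψ_1 exactly.
  have hBI : B * (I * (√(2 * Real.pi / 3) : ℝ)) = 1 := by
    have hp : (Real.pi : ℂ) ≠ 0 := ofReal_ne_zero.mpr Real.pi_ne_zero
    have hI := I_ne_zero
    have hs : ((√(2 * Real.pi) : ℝ) : ℂ) ^ 2 = 2 * Real.pi := by
      rw [← ofReal_pow, Real.sq_sqrt (by positivity)]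
      push_cast
      rfl
    calc _ = ((√3 : ℝ) * (√(2 * Real.pi / 3) : ℝ)) * (√(2 * Real.pi) : ℝ) / (2 * Real.pi) *
          (I / I) := by rw [hB]; ring
      _ = 1 := by
        rw [sqrt_three_mul_sqrt_two_pi, ← sq, hs, div_self hI, mul_one, div_self (mul_ne_zero two_ne_zero hp)]
  have hterm : ∑ m ∈ Finset.range N, u (m + 1) * l ^ m =
      A * ∑ m ∈ Finset.range N, (momentPoly 1 m).eval (zetaVar z ^ 2) * l ^ m := by
    rw [Finset.mul_sum]
    refine Finset.sum_congr rfl fun m _ => ?_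
    rw [hu, genEig, hA, mul_one]
    ring
  rw [exp_log hl.1] at hbound
  rw [genPos_eq_gaussRay hl.1 (by linarith) hz, hterm]
  generalize ∑ m ∈ Finset.range N, (momentPoly 1 m).eval (zetaVar z ^ 2) * l ^ m = S at *
  generalize gaussRay 1 (exp ((Real.pi / 3 : ℝ) * I)) (zetaVar z ^ 2) (exp (log l / 2)) -
    gaussRay 1 (exp ((-(Real.pi / 3) : ℝ) * I)) (zetaVar z ^ 2) (exp (log l / 2)) = G at *
  rw [show A * B * G - A * S = A * B * (G - I * (√(2 * Real.pi / 3) : ℝ) * S) by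
    linear_combination A * S * hBI, norm_mul, mul_assoc ‖A * B‖]
  exact mul_le_mul_of_nonneg_left hbound (norm_nonneg _)

theorem genNeg_hasGeneratingExpansion {z : ℂ} (hz : z ∈ slitPlane) {u : ℕ → ℂ}
    (hu : ∀ m, u (m + 1) = genEig (-1) m z) :
    HasGeneratingExpansion (fun l => genNeg l z) u := by
  refine hasGeneratingExpansion_of_bound fun η hη hη1 N => ?_
  obtain ⟨C, hC⟩ := gaussRay_add_expansion hη hη1 (zetaVar z ^ 2) N
  set A := zetaVar z ^ (1 / 2 : ℂ) * ((3 : ℂ) ^ (1 / 4 : ℂ) * exp (3 / 2 * zetaVar z ^ 2)) with hA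
  set B : ℂ := (√3 : ℝ) * (√(Real.pi / 2) : ℝ) / (2 * Real.pi) with hB
  refine ⟨‖A * B‖ * C, fun l hl hl1 => ?_⟩
  have hharg : |arg l| ≤ Real.pi / 2 - η := hl.2
  have hbound := hC (log l) (by rwa [exp_log hl.1]) (by rwa [log_im])
  have hBI : B * (2 * (√(2 * Real.pi / 3) : ℝ)) = 1 := by
    have hp : (Real.pi : ℂ) ≠ 0 := ofReal_ne_zero.mpr Real.pi_ne_zero
    have hs : ((√(2 * Real.pi) : ℝ) : ℂ) * ((√(Real.pi / 2) : ℝ) : ℂ) = Real.pi := by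
      rw [← ofReal_mul, ← Real.sqrt_mul (by positivity),
        show 2 * Real.pi * (Real.pi / 2) = Real.pi ^ 2 by ring, Real.sqrt_sq Real.pi_pos.le]
    calc _ = ((√3 : ℝ) : ℂ) * (√(2 * Real.pi / 3) : ℝ) * (√(Real.pi / 2) : ℝ) / Real.pi := by
          rw [hB]; field_simp
      _ = 1 := by
        rw [sqrt_three_mul_sqrt_two_pi, hs, div_self hp]
  have hterm : ∑ m ∈ Finset.range N, u (m + 1) * l ^ m =
      A * ∑ m ∈ Finset.range N, (momentPoly (-1) m).eval (zetaVar z ^ 2) * l ^ m := by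
    rw [Finset.mul_sum]
    refine Finset.sum_congr rfl fun m _ => ?_
    rw [hu, genEig, hA, show -(3 / 2) * (-1 : ℂ) = 3 / 2 by ring]
    ring
  rw [exp_log hl.1] at hbound
  rw [genNeg_eq_gaussRay hη hl.1 hharg hz, hterm]
  generalize ∑ m ∈ Finset.range N, (momentPoly (-1) m).eval (zetaVar z ^ 2) * l ^ m = S at *
  generalize gaussRay (-1) (exp ((Real.pi / 4 - η / 12 : ℝ) * I)) (zetaVar z ^ 2)
      (exp (log l / 2)) +
    gaussRay (-1) (exp ((-(Real.pi / 4 - η / 12) : ℝ) * I)) (zetaVar z ^ 2) (exp (log l / 2)) -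
    2 * gaussRay (-1) (exp ((Real.pi : ℝ) * I)) (zetaVar z ^ 2) (exp (log l / 2)) = G at *
  rw [show A * B * G - A * S = A * B * (G - 2 * (√(2 * Real.pi / 3) : ℝ) * S) by
    linear_combination A * S * hBI, norm_mul, mul_assoc ‖A * B‖]
  exact mul_le_mul_of_nonneg_left hbound (norm_nonneg _)

/-! ### The Jordan chains and the conclusion -/

theorem sign_natCast_succ (m : ℕ) : ((m + 1 : ℕ) : ℤ).sign = 1 :=
  Int.sign_eq_one_of_pos (by omega)

/-- The two Jordan chains: `chainEig (±(m + 1)) = genEig (±1) m`, and `chainEig 0 = 0`. -/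
noncomputable def chainEig (n : ℤ) : ℂ → ℂ :=
  if n = 0 then 0 else genEig (n.sign : ℂ) (n.natAbs - 1)

theorem chainEig_natCast_succ (m : ℕ) : chainEig ((m + 1 : ℕ) : ℤ) = genEig 1 m := by
  rw [chainEig, if_neg (by omega), Int.natAbs_natCast, sign_natCast_succ]
  simp

theorem chainEig_neg_natCast_succ (m : ℕ) : chainEig (-((m + 1 : ℕ) : ℤ)) = genEig (-1) m := by
  rw [chainEig, if_neg (by omega), Int.natAbs_neg, Int.natAbs_natCast, Int.sign_neg,
    sign_natCast_succ]
  simp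

theorem eq_natCast_succ_or_neg {n : ℤ} (hn : n ≠ 0) :
    ∃ m : ℕ, n = ((m + 1 : ℕ) : ℤ) ∨ n = -((m + 1 : ℕ) : ℤ) :=
  ⟨n.natAbs - 1, by omega⟩

theorem chainEig_schrodinger {n : ℤ} (hn : n ≠ 0) {z : ℂ} (hz : z ∈ slitPlane) :
    deriv (deriv (chainEig n)) z + potentialV0 z * chainEig n z = chainEig (n - n.sign) z := by
  have hδ : (-1 : ℂ) ^ 2 = 1 := by norm_num
  have h0 : ∀ z, chainEig 0 z = 0 := fun z => by simp [chainEig]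
  obtain ⟨m, rfl | rfl⟩ := eq_natCast_succ_or_neg hn
  · rw [sign_natCast_succ, chainEig_natCast_succ]
    cases m with
    | zero => rw [schrodinger_genEig_zero (one_pow 2) hz]; exact (h0 z).symm
    | succ m =>
      rw [schrodinger_genEig_succ (one_pow 2) m hz,
        show ((m + 1 + 1 : ℕ) : ℤ) - 1 = ((m + 1 : ℕ) : ℤ) by push_cast; ring,
        chainEig_natCast_succ]
  · rw [Int.sign_neg, sign_natCast_succ, chainEig_neg_natCast_succ]
    cases m with
    | zero => rw [schrodinger_genEig_zero hδ hz]; exact (h0 z).symm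
    | succ m =>
      rw [schrodinger_genEig_succ hδ m hz,
        show -((m + 1 + 1 : ℕ) : ℤ) - -1 = -((m + 1 : ℕ) : ℤ) by push_cast; ring,
        chainEig_neg_natCast_succ]

theorem proposition6p2 :
    ∃ ψ : ℤ → ℂ → ℂ,
      -- generalized eigenfunctions: the positive and the negative Jordan chain of `V₀`
      (∀ z : ℂ, ψ 0 z = 0) ∧
      (∀ n : ℤ, n ≠ 0 → DifferentiableOn ℂ (ψ n) Complex.slitPlane ∧
        ∀ z ∈ Complex.slitPlane,
          deriv (deriv (ψ n)) z + potentialV0 z * ψ n z = ψ (n - n.sign) z) ∧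
      -- the normalized first members
      (∀ z ∈ Complex.slitPlane,
        ψ 1 z = (3 : ℂ) ^ (1 / 4 : ℂ) * zetaVar z ^ (1 / 2 : ℂ) *
          Complex.exp (-(3 / 2) * zetaVar z ^ 2) ∧
        ψ (-1) z = (3 : ℂ) ^ (1 / 4 : ℂ) * zetaVar z ^ (1 / 2 : ℂ) *
          Complex.exp ((3 / 2) * zetaVar z ^ 2)) ∧
      -- they are the explicit generalized eigenfunctions, in the normalization
      -- `a = -δ`, `c = 3^{1/4}`, up to adding multiples of lower members of the same chain
      (∀ δ : ℤ, (δ = 1 ∨ δ = -1) → ∃ κ : ℕ → ℂ, κ 0 = 1 ∧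
        ∀ n : ℕ, 1 ≤ n → ∀ z ∈ Complex.slitPlane,
          ψ (δ * (n : ℤ)) z =
            ∑ j ∈ Finset.range n,
              κ j * chainFun (-(δ : ℂ)) ((3 : ℂ) ^ (1 / 4 : ℂ)) (δ * ((n : ℤ) - (j : ℤ))) z) ∧
      -- the two generating functions
      (∀ z ∈ Complex.slitPlane,
        HasGeneratingExpansion (fun l => genPos l z) (fun n : ℕ => ψ (n : ℤ) z) ∧
        HasGeneratingExpansion (fun l => genNeg l z) (fun n : ℕ => ψ (-(n : ℤ)) z)) := by
  refine ⟨chainEig, fun z => by simp [chainEig], fun n hn => ⟨?_, fun z hz =>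
    chainEig_schrodinger hn hz⟩, fun z hz => ⟨?_, ?_⟩, ?_, fun z hz =>
    ⟨genPos_hasGeneratingExpansion hz fun m => by rw [chainEig_natCast_succ],
      genNeg_hasGeneratingExpansion hz fun m => by rw [chainEig_neg_natCast_succ]⟩⟩
  · intro z hz
    rw [chainEig, if_neg hn]
    exact (differentiableAt_genEig _ _ hz).differentiableWithinAt
  · rw [show (1 : ℤ) = ((0 + 1 : ℕ) : ℤ) by norm_num, chainEig_natCast_succ, genEig, momentPoly_zero]
    simp only [Polynomial.eval_one, mul_one]
    ring
  · rw [show (-1 : ℤ) = -((0 + 1 : ℕ) : ℤ) by norm_num, chainEig_neg_natCast_succ, genEig,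
      momentPoly_zero, Polynomial.eval_one, show -(3 / 2) * (-1 : ℂ) = 3 / 2 by ring]
    ring
  · intro δ hδ
    -- κ_j is the constant term Q_j(0), and κ_0 = 1 because Q_0 = 1.
    refine ⟨fun j => momentCoeff δ (2 * j) 0, momentCoeff_zero_zero _, fun n hn z _ => ?_⟩
    obtain ⟨m, rfl⟩ : ∃ m, n = m + 1 := ⟨n - 1, by omega⟩
    rw [← genEig_eq_sum_chainFun hδ m z]
    rcases hδ with rfl | rfl
    · rw [one_mul, chainEig_natCast_succ, Int.cast_one]
    · rw [neg_one_mul, chainEig_neg_natCast_succ, Int.cast_neg, Int.cast_one]
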